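/- Let $\rho$ be a quantum state on $L^2(\mathbb R;\mathbb C)$ (a positive self-adjoint operator with trace $1$), with density matrix $\rho_{j,k}=\langle\psi_j,\rho\psi_k\rangle$, $j,k\in\mathbb N$ (inner product antilinear in the first argument), in the Fock basis $\psi_j(x)=(\sqrt\pi\,2^jj!)^{-1/2}H_j(x)e^{-x^2/2}$, $H_j(x)=(-1)^je^{x^2}\frac{d^j}{dx^j}e^{-x^2}$. Let $Q$ be multiplication by $x$ and $P=-i\,d/dx$, and let $W_\rho$ be the Wigner function of $\rho$, i.e. the integrable real function on $\mathbb R^2$ with $$\iint e^{i(uq+vp)}W_\rho(q,p)\,dq\,dp=\mathrm{Tr}\big(\rho\,e^{i(uQ+vP)}\big)\qquad(u,v\in\mathbb R),$$ and let $p_\rho(x|\phi)=\int W_\rho(x\cos\phi-t\sin\phi,\,x\sin\phi+t\cos\phi)\,dt$ be its Radon transform. (The state is assumed to have such a Wigner function.) Let $\eta\in(1/2,1]$, $n\ge1$, and let $(Y_1,\Phi_1),\dots,(Y_n,\Phi_n)$ be i.i.d. with the law of $\big(\sqrt\eta\,X+\sqrt{(1-\eta)/2}\;\xi,\ \Phi\big)$,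 where $(X,\Phi)$ has density $\frac1\pi p_\rho(x|\phi)$ with respect to Lebesgue measure on $\mathbb R\times[0,\pi]$ and $\xi$ is standard Gaussian, independent of $(X,\Phi)$. With $\gamma=\frac{1-\eta}{4\eta}$ let $f^\eta_{j,k}=f^\eta_{k,j}$ be the function with Fourier transform $\int f^\eta_{j,k}(x)e^{-itx}dx=\tilde f_{j,k}(t)e^{\gamma t^2}$, where $\tilde f_{j,k}=\tilde f_{k,j}$ and, for $j\ge k$, $$\tilde f_{k,j}(t)=\pi(-i)^{j-k}\sqrt{\tfrac{2^{k-j}k!}{j!}}\;|t|\,t^{j-k}e^{-t^2/4}L_k^{j-k}(t^2/2),\qquad L_m^\alpha(x)=\frac{e^xx^{-\alpha}}{m!}\frac{d^m}{dx^m}\big(e^{-x}x^{m+\alpha}\big).$$ Let $N\in\mathbb N$, $J(N)=\{(j,k)\in\mathbb N^2:\ 0\le j+k\le N-1\}$, $\varepsilon\in(0,1)$, and $$\hat\rho^\eta_{j,k}=\frac1n\sum_{\ell=1}^n f^\eta_{j,k}\big(Y_\ell/\sqrt\eta\big)e^{-i(k-j)\Phi_\ell}\ \text{ for }(j,k)\in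 J(N),\qquad \hat\rho^\eta_{j,k}=0\ \text{ otherwise},$$ $$t_{j,k}=2\|f^\eta_{j,k}\|_\infty\sqrt{\frac{\log(2N(N+1)/\varepsilon)}{n}},\qquad \tilde\rho^\eta_{j,k}=\frac{\hat\rho^\eta_{j,k}}{|\hat\rho^\eta_{j,k}|}\big(|\hat\rho^\eta_{j,k}|-t_{j,k}\big)_+\quad(0/0=0).$$ Then, with probability at least $1-\varepsilon$, $$\|\tilde\rho^\eta-\rho\|_2^2=\sum_{j,k\ge0}|\tilde\rho^\eta_{j,k}-\rho_{j,k}|^2\ \le\ \inf_{I\subseteq J(N)}\Big\{4\sum_{(j,k)\in I}t_{j,k}^2+\sum_{(j,k)\notin I}|\rho_{j,k}|^2\Big\}.$$ -/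

import Mathlib

open MeasureTheory ProbabilityTheory
open scoped ENNReal

noncomputable section

namespace QHT

/-! ### The space of states and the Fock basis -/

/-- The space of states `L²(ℝ; ℂ)` (inner product antilinear in the first variable). -/
abbrev H : Type := Lp ℂ 2 (volume : Measure ℝ)

/-- The (physicists') Hermite function `H_j(x) = (-1)^j e^{x²} (d/dx)^j e^{-x²}`. -/
def hermiteH (j : ℕ) (x : ℝ) : ℝ :=
  (-1) ^ j * Real.exp (x ^ 2) * iteratedDeriv j (fun y : ℝ => Real.exp (-y ^ 2)) x

/-- The `j`-th Fock function. -/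
def fock (j : ℕ) (x : ℝ) : ℝ :=
  1 / √(√Real.pi * 2 ^ j * (j.factorial : ℝ)) * hermiteH j x * Real.exp (-x ^ 2 / 2)

theorem iteratedDeriv_gauss (j : ℕ) : ∃ p : Polynomial ℝ, ∀ x : ℝ,
    iteratedDeriv j (fun y : ℝ => Real.exp (-y ^ 2)) x = p.eval x * Real.exp (-x ^ 2) := by
  induction j with
  | zero => exact ⟨1, fun x => by simp⟩
  | succ j ih =>
    obtain ⟨p, hp⟩ := ih
    refine ⟨p.derivative - 2 * Polynomial.X * p, fun x => ?_⟩
    rw [iteratedDeriv_succ, funext hp]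
    have h1 : HasDerivAt (fun y : ℝ => Real.exp (-y ^ 2)) (Real.exp (-x ^ 2) * (-(2 * x))) x := by
      have := ((hasDerivAt_pow 2 x).neg).exp
      simpa using this
    have h2 : deriv (fun y => p.eval y * Real.exp (-y ^ 2)) x = _ :=
      ((p.hasDerivAt x).mul h1).deriv
    rw [h2]
    simp
    ring

theorem memLp_pow_mul_gauss (m : ℕ) :
    MemLp (fun x : ℝ => x ^ m * Real.exp (-x ^ 2 / 2)) 2 volume := by
  have hc : Continuous (fun x : ℝ => x ^ m * Real.exp (-x ^ 2 / 2)) := by fun_prop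
  rw [memLp_two_iff_integrable_sq hc.aestronglyMeasurable]
  have h := integrable_rpow_mul_exp_neg_mul_sq (b := 1) one_pos (s := ((2 * m : ℕ) : ℝ))
    (lt_of_lt_of_le (by norm_num) (Nat.cast_nonneg _))
  refine h.congr (Filter.Eventually.of_forall fun x => ?_)
  simp only [Real.rpow_natCast]
  rw [mul_pow, ← pow_mul, ← Real.exp_nat_mul, mul_comm m 2]
  congr 2
  push_cast
  ring

theorem memLp_fock (j : ℕ) : MemLp (fun x : ℝ => ((fock j x : ℝ) : ℂ)) 2 volume := by
  obtain ⟨p, hp⟩ := iteratedDeriv_gauss j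
  have hpoly : ∀ q : Polynomial ℝ,
      MemLp (fun x : ℝ => q.eval x * Real.exp (-x ^ 2 / 2)) 2 volume := by
    intro q
    induction q using Polynomial.induction_on' with
    | add q r hq hr =>
      refine (hq.add hr).ae_eq (Filter.Eventually.of_forall fun x => ?_)
      simp [add_mul]
    | monomial m a =>
      refine ((memLp_pow_mul_gauss m).const_mul a).ae_eq (Filter.Eventually.of_forall fun x => ?_)
      simp [mul_assoc]
  refine MemLp.ofReal (K := ℂ) (((hpoly p).const_mul
    (1 / √(√Real.pi * 2 ^ j * (j.factorial : ℝ)) * (-1) ^ j)).ae_eq (Filter.Eventually.of_forall fun x => ?_))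
  have h1 : Real.exp (x ^ 2) * Real.exp (-x ^ 2) = 1 := by rw [← Real.exp_add]; simp
  change 1 / √(√Real.pi * 2 ^ j * (j.factorial : ℝ)) * (-1) ^ j *
    (p.eval x * Real.exp (-x ^ 2 / 2)) = fock j x
  simp only [fock, hermiteH, hp]
  linear_combination (-(1 / √(√Real.pi * 2 ^ j * (j.factorial : ℝ)) * (-1) ^ j * p.eval x *
    Real.exp (-x ^ 2 / 2))) * h1

/-- The `j`-th Fock vector, an element of `L²(ℝ; ℂ)`. -/
def fockVec (j : ℕ) : H := (memLp_fock j).toLp _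

/-! ### Quantum states -/

/-- `A` has trace `c`: in every orthonormal (Hilbert) basis the diagonal elements of `A` sum
to `c`. -/
def HasTrace (A : H →L[ℂ] H) (c : ℂ) : Prop :=
  ∀ (ι : Type) (b : HilbertBasis ι ℂ H), HasSum (fun i => inner ℂ (b i) (A (b i))) c

/-- Quantum states: self-adjoint positive operators on `L²(ℝ; ℂ)` of trace one
(`IsPositive` contains self-adjointness). -/
structure IsQuantumState (ρ : H →L[ℂ] H) : Prop where
  positive : ρ.IsPositive
  trace_one : HasTrace ρ 1

/-- The density matrix in the Fock basis, `ρ_{j,k} = ⟨ψ_j, ρ ψ_k⟩`. -/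
def densityMatrix (ρ : H →L[ℂ] H) (p : ℕ × ℕ) : ℂ :=
  inner ℂ (fockVec p.1) (ρ (fockVec p.2))

/-! ### Wigner function and Radon transform -/

/-- The function `x ↦ e^{i(ux + uv/2)} g(x + v)`. -/
def weylFun (u v : ℝ) (g : ℝ → ℂ) (x : ℝ) : ℂ :=
  Complex.exp (((u * x + u * v / 2 : ℝ) : ℂ) * Complex.I) * g (x + v)

theorem norm_weylFun (u v : ℝ) (g : ℝ → ℂ) (x : ℝ) : ‖weylFun u v g x‖ = ‖g (x + v)‖ := by
  rw [weylFun, norm_mul, Complex.norm_exp_ofReal_mul_I, one_mul]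

theorem eLpNorm_weylFun (u v : ℝ) (g : H) :
    eLpNorm (weylFun u v g) 2 volume = eLpNorm g 2 volume := by
  have h := eLpNorm_comp_measurePreserving (p := 2) (Lp.aestronglyMeasurable g)
    (measurePreserving_add_right (volume : Measure ℝ) v)
  rw [← h]
  exact eLpNorm_congr_norm_ae (Filter.Eventually.of_forall fun x => norm_weylFun u v g x)

theorem memLp_weylFun (u v : ℝ) (g : H) : MemLp (weylFun u v g) 2 volume := by
  refine ⟨?_, (eLpNorm_weylFun u v g).trans_lt (Lp.memLp g).2⟩
  have h1 : AEStronglyMeasurable (fun x => (g : ℝ → ℂ) (x + v)) volume :=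
    (Lp.aestronglyMeasurable g).comp_measurePreserving
      (measurePreserving_add_right (volume : Measure ℝ) v)
  have h2 : Continuous (fun x : ℝ =>
      Complex.exp (((u * x + u * v / 2 : ℝ) : ℂ) * Complex.I)) := by fun_prop
  exact h2.aestronglyMeasurable.mul h1

theorem ae_shift {P : ℝ → Prop} (v : ℝ) (h : ∀ᵐ x, P x) : ∀ᵐ x, P (x + v) :=
  (measurePreserving_add_right (volume : Measure ℝ) v).quasiMeasurePreserving.ae h

/-- The Weyl operator `exp(iuQ + ivP)`, where `Q` is multiplication by `x` and `P = -i d/dx`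
(so `[Q, P] = i`): the unitary operator `(exp(iuQ + ivP) g)(x) = e^{i(ux + uv/2)} g(x + v)`. -/
def weyl (u v : ℝ) : H →L[ℂ] H :=
  LinearIsometry.toContinuousLinearMap
    { toFun := fun g => (memLp_weylFun u v g).toLp _
      map_add' := fun g h => by
        rw [← MemLp.toLp_add, MemLp.toLp_eq_toLp_iff]
        filter_upwards [ae_shift v (Lp.coeFn_add g h)] with x hx
        simp only [weylFun, Pi.add_apply] at hx ⊢
        rw [hx, mul_add]
      map_smul' := fun c g => by
        rw [RingHom.id_apply, ← MemLp.toLp_const_smul, MemLp.toLp_eq_toLp_iff]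
        filter_upwards [ae_shift v (Lp.coeFn_smul c g)] with x hx
        simp only [weylFun, Pi.smul_apply, smul_eq_mul] at hx ⊢
        rw [hx]
        ring
      norm_map' := fun g => by
        change ‖(memLp_weylFun u v g).toLp _‖ = ‖g‖
        rw [Lp.norm_toLp, eLpNorm_weylFun, Lp.norm_def] }

/-- `W` is the Wigner function of `ρ`: the integrable real function on `ℝ²` whose Fourier
transform is `(u, v) ↦ Tr(ρ exp(iuQ + ivP))`. It is determined by `ρ` up to a null set. -/
structure IsWignerFunction (ρ : H →L[ℂ] H) (W : ℝ × ℝ → ℝ) : Prop where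
  integrable : Integrable W
  fourier : ∀ u v : ℝ, HasTrace (ρ ∘L weyl u v)
    (∫ z : ℝ × ℝ, Complex.exp (((u * z.1 + v * z.2 : ℝ) : ℂ) * Complex.I) * (W z : ℂ))

/-- The Radon transform `p(x|φ) = ∫ W(x cos φ - t sin φ, x sin φ + t cos φ) dt`. -/
def radon (W : ℝ × ℝ → ℝ) (x φ : ℝ) : ℝ :=
  ∫ t : ℝ, W (x * Real.cos φ - t * Real.sin φ, x * Real.sin φ + t * Real.cos φ)

/-! ### The law of the data -/

/-- The law of an ideal observation `(X, Φ)`: density `π⁻¹ p(x|φ)` with respect to the Lebesgue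
measure on `ℝ × [0, π]`. -/
def idealLaw (W : ℝ × ℝ → ℝ) : Measure (ℝ × ℝ) :=
  (volume.restrict (Set.univ ×ˢ Set.Icc 0 Real.pi)).withDensity
    (fun z => ENNReal.ofReal (1 / Real.pi * radon W z.1 z.2))

/-- The law of a noisy observation `(Y, Φ)`, with `Y = √η X + √((1-η)/2) ξ`, where `(X, Φ)`
follows the ideal law and `ξ` is standard Gaussian and independent of `(X, Φ)`. -/
def noisyLaw (η : ℝ) (W : ℝ × ℝ → ℝ) : Measure (ℝ × ℝ) :=
  ((idealLaw W).prod (gaussianReal 0 1)).map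
    (fun w => (√η * w.1.1 + √((1 - η) / 2) * w.2, w.1.2))

/-! ### Adapted pattern functions -/

/-- The Laguerre polynomial `L_n^α(x) = (n!)⁻¹ e^x x^{-α} (d/dx)^n (e^{-x} x^{n+α})`
(its value at `x = 0` is never used, see `patternFourier`). -/
def laguerre (n α : ℕ) (x : ℝ) : ℝ :=
  (n.factorial : ℝ)⁻¹ * Real.exp x * (x ^ α)⁻¹ *
    iteratedDeriv n (fun y : ℝ => Real.exp (-y) * y ^ (n + α)) x

/-- The Fourier transform of the pattern function `f_{j,k} = f_{k,j}`: for `j ≥ k` it is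
`π (-i)^{j-k} (2^{k-j} k! / j!)^{1/2} |t| t^{j-k} e^{-t²/4} L_k^{j-k}(t²/2)`. -/
def patternFourier (j k : ℕ) (t : ℝ) : ℂ :=
  let a := max j k
  let b := min j k
  (-Complex.I) ^ (a - b) *
    ((Real.pi * √((b.factorial : ℝ) / (2 ^ (a - b) * (a.factorial : ℝ))) * |t| * t ^ (a - b) * Real.exp (-t ^ 2 / 4) *
      laguerre b (a - b) (t ^ 2 / 2) : ℝ) : ℂ)

/-- `γ(η) = (1 - η) / (4η)`. -/
def gam (η : ℝ) : ℝ := (1 - η) / (4 * η)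

/-- The adapted pattern function `f^η_{j,k}`, whose Fourier transform `∫ f(x) e^{-itx} dx` is the
one of the pattern function times `e^{γ t²}`. -/
def pattern (η : ℝ) (j k : ℕ) (x : ℝ) : ℂ :=
  1 / (2 * Real.pi) * ∫ t : ℝ, Complex.exp (((t * x : ℝ) : ℂ) * Complex.I) *
    (patternFourier j k t * (Real.exp (gam η * t ^ 2) : ℂ))

/-- The supremum norm of a function on `ℝ`. -/
def supNorm (f : ℝ → ℂ) : ℝ := ⨆ x : ℝ, ‖f x‖

/-- The supremum in `supNorm (pattern η j k)` is a supremum of a bounded set. -/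
theorem bddAbove_pattern (η : ℝ) (j k : ℕ) :
    BddAbove (Set.range fun x : ℝ => ‖pattern η j k x‖) := by
  refine ⟨‖(1 / (2 * Real.pi) : ℂ)‖ * ∫ t : ℝ,
    ‖patternFourier j k t * (Real.exp (gam η * t ^ 2) : ℂ)‖, ?_⟩
  rintro _ ⟨x, rfl⟩
  simp only [pattern]
  rw [norm_mul]
  refine mul_le_mul_of_nonneg_left ((norm_integral_le_integral_norm _).trans_eq ?_) (norm_nonneg _)
  congr 1
  funext t
  rw [norm_mul, Complex.norm_exp_ofReal_mul_I, one_mul]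

/-! ### The estimators -/

/-- `J(N) = {(j, k) : 0 ≤ j + k ≤ N - 1}`. -/
def J (N : ℕ) : Finset (ℕ × ℕ) :=
  (Finset.range N ×ˢ Finset.range N).filter (fun p => p.1 + p.2 < N)

theorem mem_J {N : ℕ} {p : ℕ × ℕ} : p ∈ J N ↔ p.1 + p.2 < N := by
  simp only [J, Finset.mem_filter, Finset.mem_product, Finset.mem_range]
  omega

/-- `G_{j,k}(x, φ) = f^η_{j,k}(x) e^{-i(k-j)φ}`. -/
def G (η : ℝ) (p : ℕ × ℕ) (x φ : ℝ) : ℂ :=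
  pattern η p.1 p.2 x * Complex.exp (-Complex.I * ((p.2 : ℂ) - (p.1 : ℂ)) * (φ : ℂ))

/-- The initial estimator computed from the data `(y_ℓ, φ_ℓ)`, `ℓ = 1, …, n`. -/
def initialEst (η : ℝ) (N : ℕ) {n : ℕ} (y φ : Fin n → ℝ) (p : ℕ × ℕ) : ℂ :=
  if p ∈ J N then 1 / (n : ℂ) * ∑ l : Fin n, G η p (y l / √η) (φ l) else 0

/-- The thresholds `t_{j,k}`. -/
def threshold (η ε : ℝ) (N n : ℕ) (p : ℕ × ℕ) : ℝ :=
  2 * supNorm (pattern η p.1 p.2) * √(Real.log (2 * N * (N + 1) / ε) / n)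

/-- The soft-thresholding operator `z ↦ z/|z| (|z| - t)_+`, with `0/0 = 0`. -/
def softThreshold (t : ℝ) (z : ℂ) : ℂ := z / (‖z‖ : ℂ) * ((max (‖z‖ - t) 0 : ℝ) : ℂ)

/-- The soft-thresholded estimator. -/
def finalEst (η ε : ℝ) (N : ℕ) {n : ℕ} (y φ : Fin n → ℝ) (p : ℕ × ℕ) : ℂ :=
  softThreshold (threshold η ε N n p) (initialEst η N y φ p)

/-- The squared `ℓ₂`-norm of an infinite matrix, as an element of `[0, ∞]`. -/
def sqNorm (ν : ℕ × ℕ → ℂ) : ℝ≥0∞ := ∑' p : ℕ × ℕ, ENNReal.ofReal (‖ν p‖ ^ 2)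

end QHT

end

/-! The argument combines unbiasedness, concentration, and a deterministic fact about soft
thresholding.

Unbiasedness (`integral_G_noisyLaw`). The Fourier transform of f_{j,k}, times the phase
e^{-i(k-j)φ}, is π|t| times the matrix element ⟨ψ_j, e^{-i(uQ+vP)} ψ_k⟩ at (u,v) = t(cos φ, sin φ);
this is `patternFourier_mul_cexp`. By the Fourier slice theorem, the mean over an ideal observation
is then, up to a constant, the integral over the plane, in polar coordinates with Jacobian |t|, of
Tr(ρ e^{i(uQ+vP)}) against that matrix element. Moyal's identity
(`integral_inner_weyl_mul_weylKernel`), summed over an orthonormal basis, shows that this integral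
is 2πρ_{j,k}. The Gaussian noise multiplies Fourier transforms by e^{-γt²}, which the factor e^{γt²}
in the adapted pattern function undoes. That factor is affordable because the matrix elements decay
like a polynomial times e^{-t²/4}, and γ < 1/4 exactly when η > 1/2.

Concentration (`hoeffding_bounded_complex`). The summands are bounded by the sup norm of f^η_{j,k}.
Hoeffding's inequality for real and imaginary parts, with a union bound over the N(N+1)/2 entries of
J(N), puts every initial estimate within t_{j,k} of ρ_{j,k} with probability at least 1 - ε.

Thresholding (`oracle_inequality`). If |z - r| ≤ t, then soft thresholding z at t gives a point at
distance at most 2t and at most |r| from r. The first bound is used on I and the second off I. One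
event serves every I, so the infimum stands inside it. -/

noncomputable section

namespace QHT

/-! ### Hermite polynomials -/

/-- The Hermite polynomials, defined by their recursion. -/
def hermitePoly : ℕ → Polynomial ℝ
  | 0 => 1
  | j + 1 => 2 * Polynomial.X * hermitePoly j - Polynomial.derivative (hermitePoly j)

theorem hermitePoly_succ (j : ℕ) : hermitePoly (j + 1) =
    2 * Polynomial.X * hermitePoly j - Polynomial.derivative (hermitePoly j) := rfl

theorem derivative_hermitePoly_succ (j : ℕ) :
    Polynomial.derivative (hermitePoly (j + 1)) = (2 * (j + 1) : ℝ) • hermitePoly j := by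
  induction j with
  | zero =>
    simp only [hermitePoly, Polynomial.smul_eq_C_mul, Polynomial.derivative_one, mul_one, sub_zero,
      Polynomial.derivative_mul, Polynomial.derivative_ofNat, Polynomial.derivative_X]
    simp [map_ofNat]
  | succ j ih =>
    rw [hermitePoly_succ (j + 1), Polynomial.derivative_sub, Polynomial.derivative_mul, ih,
      Polynomial.derivative_smul, hermitePoly_succ j]
    simp only [Polynomial.smul_eq_C_mul, Polynomial.derivative_mul, Polynomial.derivative_ofNat,
      Polynomial.derivative_X, map_mul, map_add, map_ofNat, map_natCast, map_one]
    push_cast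
    ring

theorem iteratedDeriv_gauss_eq (j : ℕ) (x : ℝ) :
    iteratedDeriv j (fun y : ℝ => Real.exp (-y ^ 2)) x =
      (-1) ^ j * (hermitePoly j).eval x * Real.exp (-x ^ 2) := by
  induction j generalizing x with
  | zero => simp [hermitePoly]
  | succ j ih =>
    rw [iteratedDeriv_succ, funext ih]
    have h1 : HasDerivAt (fun y : ℝ => Real.exp (-y ^ 2)) (Real.exp (-x ^ 2) * (-(2 * x))) x := by
      simpa using ((hasDerivAt_pow 2 x).neg).exp
    have h2 := ((((hermitePoly j).hasDerivAt x).const_mul ((-1 : ℝ) ^ j)).mul h1).deriv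
    refine (h2.trans ?_)
    simp only [hermitePoly_succ, Polynomial.eval_sub, Polynomial.eval_mul, Polynomial.eval_X,
      Polynomial.eval_ofNat]
    ring

theorem hermiteH_eq (j : ℕ) (x : ℝ) : hermiteH j x = (hermitePoly j).eval x := by
  rw [hermiteH, iteratedDeriv_gauss_eq]
  have h1 : Real.exp (x ^ 2) * Real.exp (-x ^ 2) = 1 := by rw [← Real.exp_add]; simp
  have h2 : ((-1 : ℝ) ^ j) * (-1) ^ j = 1 := by rw [← mul_pow]; simp
  linear_combination (hermitePoly j).eval x * (-1) ^ j * (-1) ^ j * h1 +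
    (hermitePoly j).eval x * h2

/-! ### Polynomials times the Gaussian -/

/-- The function `q(x) e^{-x²/2}`. -/
def polyGauss (q : Polynomial ℝ) (x : ℝ) : ℂ := ((q.eval x * Real.exp (-x ^ 2 / 2) : ℝ) : ℂ)

theorem continuous_polyGauss (q : Polynomial ℝ) : Continuous (polyGauss q) := by
  unfold polyGauss
  fun_prop

theorem memLp_polyGauss (q : Polynomial ℝ) : MemLp (polyGauss q) 2 volume := by
  suffices h : MemLp (fun x : ℝ => q.eval x * Real.exp (-x ^ 2 / 2)) 2 volume from h.ofReal
  induction q using Polynomial.induction_on' with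
  | add q r hq hr =>
    refine (hq.add hr).ae_eq (Filter.Eventually.of_forall fun x => ?_)
    simp [add_mul]
  | monomial m a =>
    refine ((memLp_pow_mul_gauss m).const_mul a).ae_eq (Filter.Eventually.of_forall fun x => ?_)
    simp [mul_assoc]

theorem hasDerivAt_polyGauss (q : Polynomial ℝ) (x : ℝ) :
    HasDerivAt (polyGauss q)
      (polyGauss (Polynomial.derivative q - Polynomial.X * q) x) x := by
  have h1 : HasDerivAt (fun y : ℝ => Real.exp (-y ^ 2 / 2)) (Real.exp (-x ^ 2 / 2) * (-x)) x := by
    have h := (((hasDerivAt_id x).pow 2).neg.div_const 2).exp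
    simp only [id, Pi.neg_apply, Pi.pow_apply] at h
    refine h.congr_deriv ?_
    push_cast
    ring
  refine ((q.hasDerivAt x).mul h1).ofReal_comp.congr_deriv ?_
  simp only [polyGauss, Polynomial.eval_sub, Polynomial.eval_mul, Polynomial.eval_X]
  congr 1
  ring

/-- The integrand of the ambiguity function of two polynomials times Gaussians. -/
def ambiguityFun (u v : ℝ) (p q : Polynomial ℝ) (x : ℝ) : ℂ :=
  polyGauss p x * Complex.exp (Complex.I * u * x) * polyGauss q (x + v)

/-- The ambiguity function `∫ p(x) e^{-x²/2} e^{iux} q(x + v) e^{-(x + v)²/2} dx`. -/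
def ambiguity (u v : ℝ) (p q : Polynomial ℝ) : ℂ := ∫ x : ℝ, ambiguityFun u v p q x

theorem integrable_ambiguityFun (u v : ℝ) (p q : Polynomial ℝ) :
    Integrable (ambiguityFun u v p q) := by
  have hq : MemLp (fun x => polyGauss q (x + v)) 2 volume :=
    (memLp_polyGauss q).comp_measurePreserving
      (measurePreserving_add_right (volume : Measure ℝ) v)
  have h := (memLp_polyGauss p).integrable_mul hq
  have hc : Continuous (ambiguityFun u v p q) := by
    unfold ambiguityFun
    have := continuous_polyGauss p
    have := continuous_polyGauss q
    fun_prop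
  refine h.mono hc.aestronglyMeasurable (Filter.Eventually.of_forall fun x => ?_)
  have h1 : ‖Complex.exp (Complex.I * u * x)‖ = 1 := by
    rw [show Complex.I * u * x = ((u * x : ℝ) : ℂ) * Complex.I by push_cast; ring,
      Complex.norm_exp_ofReal_mul_I]
  simp [ambiguityFun, h1]

theorem ambiguity_add_left (u v : ℝ) (p q r : Polynomial ℝ) :
    ambiguity u v (p + q) r = ambiguity u v p r + ambiguity u v q r := by
  simp only [ambiguity]
  rw [← integral_add (integrable_ambiguityFun ..) (integrable_ambiguityFun ..)]
  congr 1; ext x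
  simp only [ambiguityFun, polyGauss, Polynomial.eval_add]
  push_cast; ring

theorem ambiguity_add_right (u v : ℝ) (p q r : Polynomial ℝ) :
    ambiguity u v p (q + r) = ambiguity u v p q + ambiguity u v p r := by
  simp only [ambiguity]
  rw [← integral_add (integrable_ambiguityFun ..) (integrable_ambiguityFun ..)]
  congr 1; ext x
  simp only [ambiguityFun, polyGauss, Polynomial.eval_add]
  push_cast; ring

theorem ambiguity_smul_left (u v c : ℝ) (p q : Polynomial ℝ) :
    ambiguity u v (c • p) q = c * ambiguity u v p q := by
  simp only [ambiguity]
  rw [← integral_const_mul]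
  congr 1; ext x
  simp only [ambiguityFun, polyGauss, Polynomial.eval_smul, smul_eq_mul]
  push_cast; ring

theorem ambiguity_smul_right (u v c : ℝ) (p q : Polynomial ℝ) :
    ambiguity u v p (c • q) = c * ambiguity u v p q := by
  simp only [ambiguity]
  rw [← integral_const_mul]
  congr 1; ext x
  simp only [ambiguityFun, polyGauss, Polynomial.eval_smul, smul_eq_mul]
  push_cast; ring

theorem ambiguity_X_mul (u v : ℝ) (p q : Polynomial ℝ) :
    ambiguity u v p (Polynomial.X * q) = ambiguity u v (Polynomial.X * p) q +
      v * ambiguity u v p q := by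
  simp only [ambiguity]
  rw [← integral_const_mul, ← integral_add (integrable_ambiguityFun ..)
    ((integrable_ambiguityFun ..).const_mul _)]
  congr 1; ext x
  simp only [ambiguityFun, polyGauss, Polynomial.eval_mul, Polynomial.eval_X]
  push_cast; ring

/-- Integration by parts: the three terms are the product rule for the integrand, whose derivative
has integral zero. -/
theorem ambiguity_deriv (u v : ℝ) (p q : Polynomial ℝ) :
    ambiguity u v (Polynomial.derivative p - Polynomial.X * p) q +
      Complex.I * u * ambiguity u v p q +
      ambiguity u v p (Polynomial.derivative q - Polynomial.X * q) = 0 := by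
  have hsum : ambiguity u v (Polynomial.derivative p - Polynomial.X * p) q +
      Complex.I * u * ambiguity u v p q +
      ambiguity u v p (Polynomial.derivative q - Polynomial.X * q) =
      ∫ x : ℝ, ((ambiguityFun u v (Polynomial.derivative p - Polynomial.X * p) q +
        fun x => Complex.I * u * ambiguityFun u v p q x) +
        ambiguityFun u v p (Polynomial.derivative q - Polynomial.X * q)) x := by
    rw [integral_add' ((integrable_ambiguityFun ..).add ((integrable_ambiguityFun ..).const_mul _))
      (integrable_ambiguityFun ..), integral_add' (integrable_ambiguityFun ..)
      ((integrable_ambiguityFun ..).const_mul _), integral_const_mul]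
    rfl
  rw [hsum]
  refine integral_eq_zero_of_hasDerivAt_of_integrable (f := ambiguityFun u v p q) (fun x => ?_)
    (((integrable_ambiguityFun ..).add ((integrable_ambiguityFun ..).const_mul _)).add
      (integrable_ambiguityFun ..)) (integrable_ambiguityFun ..)
  have hE : HasDerivAt (fun y : ℝ => Complex.exp (Complex.I * u * y))
      (Complex.exp (Complex.I * u * x) * (Complex.I * u)) x := by
    have h := ((hasDerivAt_id x).ofReal_comp.const_mul (Complex.I * u)).cexp
    simpa using h
  have hq : HasDerivAt (fun y : ℝ => polyGauss q (y + v)) _ x :=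
    (hasDerivAt_polyGauss q (x + v)).comp_add_const x v
  refine (((hasDerivAt_polyGauss p x).mul hE).mul hq).congr_deriv ?_
  simp only [ambiguityFun, Pi.add_apply, Pi.mul_apply]
  ring

/-- The creation operator on one factor is moved to the other as an annihilation operator, here the
derivative of the polynomial; passing the phase and the translation costs a scalar. With
`hermitePoly_succ` this yields recursions in the indices. -/
theorem ambiguity_hermite_left (u v : ℝ) (p q : Polynomial ℝ) :
    ambiguity u v (2 * Polynomial.X * p - Polynomial.derivative p) q =
      (Complex.I * u - v) * ambiguity u v p q + ambiguity u v p (Polynomial.derivative q) := by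
  have h0 := ambiguity_deriv u v p q
  have h1 := ambiguity_X_mul u v p q
  have h2 : ambiguity u v (Polynomial.X * p) q = ambiguity u v
      (2 * Polynomial.X * p - Polynomial.derivative p) q +
      ambiguity u v (Polynomial.derivative p - Polynomial.X * p) q := by
    rw [← ambiguity_add_left]; congr 1; ring
  have h3 : ambiguity u v p (Polynomial.derivative q) =
      ambiguity u v p (Polynomial.derivative q - Polynomial.X * q) +
      ambiguity u v p (Polynomial.X * q) := by
    rw [← ambiguity_add_right]; congr 1; ring
  linear_combination -h0 - h1 - h2 - h3

theorem ambiguity_hermite_right (u v : ℝ) (p q : Polynomial ℝ) :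
    ambiguity u v p (2 * Polynomial.X * q - Polynomial.derivative q) =
      (Complex.I * u + v) * ambiguity u v p q + ambiguity u v (Polynomial.derivative p) q := by
  have h0 := ambiguity_deriv u v p q
  have h1 := ambiguity_X_mul u v p q
  have h2 : ambiguity u v p (Polynomial.X * q) = ambiguity u v p
      (2 * Polynomial.X * q - Polynomial.derivative q) +
      ambiguity u v p (Polynomial.derivative q - Polynomial.X * q) := by
    rw [← ambiguity_add_right]; congr 1; ring
  have h3 : ambiguity u v (Polynomial.derivative p) q =
      ambiguity u v (Polynomial.derivative p - Polynomial.X * p) q +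
      ambiguity u v (Polynomial.X * p) q := by
    rw [← ambiguity_add_left]; congr 1; ring
  linear_combination -h0 + h1 - h2 - h3

theorem ambiguity_one_one (u v : ℝ) :
    ambiguity u v 1 1 = (√Real.pi : ℂ) *
      Complex.exp (-((u : ℂ) ^ 2 + (v : ℂ) ^ 2) / 4 - Complex.I * u * v / 2) := by
  have h := integral_cexp_quadratic (b := -1) (by simp) (Complex.I * u - v) (-(v : ℂ) ^ 2 / 2)
  have h1 : ∀ x : ℝ, ambiguityFun u v 1 1 x =
      Complex.exp (-1 * (x : ℂ) ^ 2 + (Complex.I * u - v) * x + -(v : ℂ) ^ 2 / 2) := by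
    intro x
    simp only [ambiguityFun, polyGauss, Polynomial.eval_one, one_mul, Complex.ofReal_exp]
    rw [← Complex.exp_add, ← Complex.exp_add]
    congr 1
    push_cast
    ring
  rw [ambiguity, funext h1, h]
  congr 1
  · rw [neg_neg, div_one, Real.sqrt_eq_rpow, Complex.ofReal_cpow Real.pi_nonneg]
    norm_num
  · congr 1
    ring_nf
    rw [Complex.I_sq]
    ring

/-! ### The polynomial part of the ambiguity function -/

/-- The polynomial part of the ambiguity function of two Hermite functions. -/
def laguerrePoly2 (j k : ℕ) (a b : ℂ) : ℂ :=
  ∑ m ∈ Finset.range (j + 1), (m.factorial : ℂ) * (j.choose m : ℂ) * (k.choose m : ℂ) * 2 ^ m *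
    a ^ (j - m) * b ^ (k - m)

theorem laguerrePoly2_zero_left (k : ℕ) (a b : ℂ) : laguerrePoly2 0 k a b = b ^ k := by
  simp [laguerrePoly2]

theorem laguerrePoly2_zero_right (j : ℕ) (a b : ℂ) : laguerrePoly2 j 0 a b = a ^ j := by
  rw [laguerrePoly2, Finset.sum_eq_single 0]
  · simp
  · intro m _ hm
    simp [Nat.choose_eq_zero_of_lt (Nat.pos_of_ne_zero hm)]
  · simp

/-- Pascal's rule in j splits the sum; in one half, (m+1)! C(k+1, m+1) = (k+1) m! C(k, m) extracts
the factor k+1. It is the recursion that `ambiguity_hermite_left` and `derivative_hermitePoly_succ`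
give for Hermite polynomials. -/
theorem laguerrePoly2_succ_succ (j k : ℕ) (a b : ℂ) :
    laguerrePoly2 (j + 1) (k + 1) a b =
      a * laguerrePoly2 j (k + 1) a b + 2 * (k + 1) * laguerrePoly2 j k a b := by
  have hS : ∀ m : ℕ, ((j + 1).choose (m + 1) : ℂ) = (j.choose m : ℂ) + (j.choose (m + 1) : ℂ) := by
    intro m
    rw [Nat.choose_succ_succ]
    push_cast
    rfl
  have hK : ∀ m : ℕ, ((m + 1).factorial : ℂ) * ((k + 1).choose (m + 1) : ℂ) =
      (k + 1) * ((m.factorial : ℂ) * (k.choose m : ℂ)) := by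
    intro m
    have h := Nat.add_one_mul_choose_eq k m
    have h' : ((k : ℂ) + 1) * (k.choose m : ℂ) = ((k + 1).choose (m + 1) : ℂ) * (m + 1) := by
      exact_mod_cast h
    rw [Nat.factorial_succ]
    push_cast
    linear_combination (-(m.factorial : ℂ)) * h'
  -- The added term m = j + 1 vanishes, since C(j, j+1) = 0.
  have hA : a * laguerrePoly2 j (k + 1) a b = ∑ m ∈ Finset.range (j + 2),
      (m.factorial : ℂ) * (j.choose m : ℂ) * ((k + 1).choose m : ℂ) * 2 ^ m *
        a ^ (j + 1 - m) * b ^ (k + 1 - m) := by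
    rw [Finset.sum_range_succ, Nat.choose_succ_self, laguerrePoly2, Finset.mul_sum]
    simp only [Nat.cast_zero, mul_zero, zero_mul, add_zero]
    refine Finset.sum_congr rfl fun m hm => ?_
    rw [Nat.succ_sub (Nat.lt_succ_iff.mp (Finset.mem_range.mp hm)), pow_succ]
    ring
  rw [hA, laguerrePoly2, Finset.sum_range_succ', Finset.sum_range_succ' _ (j + 1),
    laguerrePoly2, Finset.mul_sum]
  simp only [hS, Nat.choose_zero_right, Nat.reduceSubDiff]
  rw [add_right_comm, ← Finset.sum_add_distrib]
  congr 1
  refine Finset.sum_congr rfl fun m _ => ?_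
  rw [pow_succ (2 : ℂ)]
  linear_combination ((j.choose m : ℂ) * (2 ^ m * 2) * a ^ (j - m) * b ^ (k - m)) * hK m

theorem ambiguity_hermitePoly (u v : ℝ) (j k : ℕ) :
    ambiguity u v (hermitePoly j) (hermitePoly k) =
      ambiguity u v 1 1 * laguerrePoly2 j k (Complex.I * u - v) (Complex.I * u + v) := by
  induction j generalizing k with
  | zero =>
    rw [laguerrePoly2_zero_left]
    induction k with
    | zero => simp [hermitePoly]
    | succ k ih =>
      rw [hermitePoly_succ, ambiguity_hermite_right, ih]
      have : Polynomial.derivative (hermitePoly 0) = (0 : ℝ) • 1 := by simp [hermitePoly]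
      rw [this, ambiguity_smul_left]
      push_cast
      ring
  | succ j ih =>
    rw [hermitePoly_succ, ambiguity_hermite_left, ih]
    cases k with
    | zero =>
      have : Polynomial.derivative (hermitePoly 0) = (0 : ℝ) • 1 := by simp [hermitePoly]
      rw [this, ambiguity_smul_right, laguerrePoly2_zero_right, laguerrePoly2_zero_right]
      push_cast
      ring
    | succ k =>
      rw [derivative_hermitePoly_succ, ambiguity_smul_right, ih, laguerrePoly2_succ_succ]
      push_cast
      ring

/-! ### Laguerre polynomials -/

/-- Leibniz's rule applied to the Rodrigues formula. The point 0 is excluded because `laguerre`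
divides by x^α. -/
theorem laguerre_eq_sum (n α : ℕ) {x : ℝ} (hx : x ≠ 0) :
    laguerre n α x =
      ∑ i ∈ Finset.range (n + 1), (-1) ^ i * ((n + α).choose (n - i) : ℝ) * x ^ i /
        (i.factorial : ℝ) := by
  have hexp : ∀ i : ℕ, iteratedDeriv i (fun y : ℝ => Real.exp (-y)) x =
      (-1) ^ i * Real.exp (-x) := by
    intro i
    have h := congrFun (iteratedDeriv_exp_const_mul i (-1)) x
    simpa using h
  have hL : iteratedDeriv n (fun y : ℝ => Real.exp (-y) * y ^ (n + α)) x =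
      ∑ i ∈ Finset.range (n + 1), (n.choose i : ℝ) * ((-1) ^ i * Real.exp (-x)) *
        (((n + α).descFactorial (n - i) : ℝ) * x ^ (n + α - (n - i))) := by
    rw [iteratedDeriv_fun_mul (by fun_prop) (by fun_prop)]
    simp only [hexp, iteratedDeriv_pow]
  rw [laguerre, hL, Finset.mul_sum]
  refine Finset.sum_congr rfl fun i hi => ?_
  have hi' : i ≤ n := Nat.lt_succ_iff.mp (Finset.mem_range.mp hi)
  rw [show n + α - (n - i) = α + i by omega, pow_add, Nat.descFactorial_eq_factorial_mul_choose]
  have hE : Real.exp x * Real.exp (-x) = 1 := by rw [← Real.exp_add]; simp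
  have hC : (n.choose i : ℝ) * i.factorial * (n - i).factorial = n.factorial := by
    exact_mod_cast Nat.choose_mul_factorial_mul_factorial hi'
  have h0 : (n.factorial : ℝ) ≠ 0 := by positivity
  have h1 : (i.factorial : ℝ) ≠ 0 := by positivity
  have h2 : x ^ α ≠ 0 := pow_ne_zero _ hx
  push_cast
  field_simp
  calc _ = (Real.exp x * Real.exp (-x)) * ((n.choose i : ℝ) * i.factorial * (n - i).factorial) *
        (n + α).choose (n - i) := by ring
    _ = _ := by rw [hE, hC]; ring

theorem laguerrePoly2_comm (j k : ℕ) (a b : ℂ) : laguerrePoly2 j k a b = laguerrePoly2 k j b a := by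
  have key : ∀ j k : ℕ, ∀ a b : ℂ, laguerrePoly2 j k a b = ∑ m ∈ Finset.range (j + k + 1),
      (m.factorial : ℂ) * (j.choose m : ℂ) * (k.choose m : ℂ) * 2 ^ m *
        a ^ (j - m) * b ^ (k - m) := by
    intro j k a b
    refine Finset.sum_subset (Finset.range_mono (by omega)) fun m _ hm => ?_
    rw [Nat.choose_eq_zero_of_lt (n := j) (by simpa using hm)]
    simp
  rw [key, key, add_comm j k]
  exact Finset.sum_congr rfl fun m _ => by ring

/-- Summing in reverse order, m = k - i, exhibits the Laguerre polynomial L_k^d at -ab/2. -/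
theorem laguerrePoly2_eq_sum (k d : ℕ) (a b : ℂ) :
    laguerrePoly2 k (k + d) a b = 2 ^ k * k.factorial * b ^ d *
      ∑ i ∈ Finset.range (k + 1), (-1) ^ i * ((k + d).choose (k - i) : ℂ) * (-(a * b) / 2) ^ i /
        (i.factorial : ℂ) := by
  rw [laguerrePoly2, ← Finset.sum_range_reflect, Finset.mul_sum]
  refine Finset.sum_congr rfl fun i hi => ?_
  have hi' : i ≤ k := Nat.lt_succ_iff.mp (Finset.mem_range.mp hi)
  rw [show k + 1 - 1 - i = k - i by omega, show k - (k - i) = i by omega,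
    show k + d - (k - i) = d + i by omega, Nat.choose_symm hi']
  have hC : (k.choose i : ℂ) * i.factorial * (k - i).factorial = k.factorial := by
    exact_mod_cast Nat.choose_mul_factorial_mul_factorial hi'
  have h1 : (i.factorial : ℂ) ≠ 0 := by exact_mod_cast i.factorial_ne_zero
  have h2 : (2 : ℂ) ^ k = 2 ^ (k - i) * 2 ^ i := by rw [← pow_add]; congr 1; omega
  have h3 : ((-1 : ℂ)) ^ i * (-(a * b) / 2) ^ i * 2 ^ i = a ^ i * b ^ i := by
    rw [← mul_pow, ← mul_pow, ← mul_pow]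
    congr 1
    ring
  rw [← hC, h2, pow_add]
  field_simp
  linear_combination (-(k.choose i : ℂ) * (k - i).factorial * b ^ d *
    (k + d).choose (k - i)) * h3

/-! ### The matrix elements of the Weyl operators -/

/-- The matrix element `⟨ψ_j, exp(-iuQ - ivP) ψ_k⟩` of a Weyl operator in the Fock basis. -/
def weylKernel (j k : ℕ) (u v : ℝ) : ℂ :=
  ((√(2 ^ (j + k) * (j.factorial * k.factorial : ℝ)))⁻¹ * Real.exp (-(u ^ 2 + v ^ 2) / 4) : ℝ) *
    laguerrePoly2 k j (-(Complex.I * u) - v) (-(Complex.I * u) + v)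

theorem continuous_weylKernel (j k : ℕ) :
    Continuous fun z : ℝ × ℝ => weylKernel j k z.1 z.2 := by
  unfold weylKernel laguerrePoly2
  fun_prop

theorem continuous_weylKernel_left (j k : ℕ) (v : ℝ) :
    Continuous fun u : ℝ => weylKernel j k u v := by
  unfold weylKernel laguerrePoly2
  fun_prop

theorem norm_laguerrePoly2_le (j k : ℕ) : ∃ C : ℝ, ∀ (s : ℝ) (a b : ℂ), 1 ≤ s → ‖a‖ ≤ s →
    ‖b‖ ≤ s → ‖laguerrePoly2 j k a b‖ ≤ C * s ^ (j + k) := by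
  refine ⟨∑ m ∈ Finset.range (j + 1),
    (m.factorial : ℝ) * (j.choose m : ℝ) * (k.choose m : ℝ) * 2 ^ m, fun s a b hs ha hb => ?_⟩
  rw [laguerrePoly2, Finset.sum_mul]
  refine (norm_sum_le _ _).trans (Finset.sum_le_sum fun m _ => ?_)
  simp only [norm_mul, norm_pow, Complex.norm_natCast, Complex.norm_ofNat]
  rw [mul_assoc]
  refine mul_le_mul_of_nonneg_left ?_ (by positivity)
  calc ‖a‖ ^ (j - m) * ‖b‖ ^ (k - m) ≤ s ^ (j - m) * s ^ (k - m) := by gcongr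
    _ = s ^ (j - m + (k - m)) := by rw [pow_add]
    _ ≤ s ^ (j + k) := pow_le_pow_right₀ hs (by omega)

/-- Bounding both arguments by (1+|u|)(1+|v|) rather than by a sum makes the bound a product, so
integrability on the plane reduces to one variable. The rate 1/4 is what later limits γ. -/
theorem norm_weylKernel_le (j k : ℕ) : ∃ C : ℝ, ∃ m : ℕ, ∀ u v : ℝ, ‖weylKernel j k u v‖ ≤
    C * (((1 + |u|) ^ m * Real.exp (-(1 / 4) * u ^ 2)) *
      ((1 + |v|) ^ m * Real.exp (-(1 / 4) * v ^ 2))) := by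
  obtain ⟨C, hC⟩ := norm_laguerrePoly2_le k j
  refine ⟨(√(2 ^ (j + k) * (j.factorial * k.factorial : ℝ)))⁻¹ * C, k + j, fun u v => ?_⟩
  have hs : (1 : ℝ) ≤ (1 + |u|) * (1 + |v|) := by nlinarith [abs_nonneg u, abs_nonneg v]
  have hn : ∀ c : ℂ, ‖c‖ ≤ |v| → ‖-(Complex.I * u) + c‖ ≤ (1 + |u|) * (1 + |v|) := by
    intro c hc
    refine (norm_add_le _ _).trans ?_
    rw [norm_neg, norm_mul, Complex.norm_I, Complex.norm_real, Real.norm_eq_abs]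
    nlinarith [abs_nonneg u, abs_nonneg v]
  have h := hC ((1 + |u|) * (1 + |v|)) (-(Complex.I * u) - v) (-(Complex.I * u) + v) hs
    (by rw [sub_eq_add_neg]; exact hn _ (by simp)) (hn _ (by simp))
  rw [weylKernel, norm_mul, Complex.norm_real, Real.norm_of_nonneg (by positivity)]
  calc _ ≤ _ := mul_le_mul_of_nonneg_left h (by positivity)
    _ = _ := by
      rw [show -(u ^ 2 + v ^ 2) / 4 = -(1 / 4) * u ^ 2 + -(1 / 4) * v ^ 2 by ring, Real.exp_add,
        mul_pow]
      ring

theorem integrable_one_add_abs_pow_mul_gauss (m : ℕ) {b : ℝ} (hb : 0 < b) :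
    Integrable fun x : ℝ => (1 + |x|) ^ m * Real.exp (-b * x ^ 2) := by
  have h0 := integrable_exp_neg_mul_sq hb
  have h1 := (integrable_rpow_mul_exp_neg_mul_sq (b := b) hb (s := (m : ℝ))
    (lt_of_lt_of_le (by norm_num) (Nat.cast_nonneg _))).norm
  refine ((h0.add h1).const_mul (2 ^ (m - 1))).mono (by fun_prop)
    (Filter.Eventually.of_forall fun x => ?_)
  rw [Pi.add_apply, Real.norm_of_nonneg (by positivity), Real.norm_of_nonneg
    (mul_nonneg (by positivity) (add_nonneg (Real.exp_pos _).le (norm_nonneg _)))]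
  simp only [Real.rpow_natCast, norm_mul, norm_pow, Real.norm_eq_abs, Real.abs_exp]
  have h2 := add_pow_le (zero_le_one (α := ℝ)) (abs_nonneg x) m
  rw [one_pow] at h2
  calc _ ≤ 2 ^ (m - 1) * (1 + |x| ^ m) * Real.exp (-b * x ^ 2) :=
        mul_le_mul_of_nonneg_right h2 (Real.exp_pos _).le
    _ = _ := by ring

theorem integrable_weylKernel (j k : ℕ) :
    Integrable fun z : ℝ × ℝ => weylKernel j k z.1 z.2 := by
  obtain ⟨C, m, h⟩ := norm_weylKernel_le j k
  have hg := integrable_one_add_abs_pow_mul_gauss m (b := 1 / 4) (by norm_num)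
  exact ((hg.mul_prod hg).const_mul C).mono' (continuous_weylKernel j k).aestronglyMeasurable
    (Filter.Eventually.of_forall fun z => h z.1 z.2)

theorem integrable_weylKernel_left (j k : ℕ) (v : ℝ) :
    Integrable fun u : ℝ => weylKernel j k u v := by
  obtain ⟨C, m, h⟩ := norm_weylKernel_le j k
  have hg := integrable_one_add_abs_pow_mul_gauss m (b := 1 / 4) (by norm_num)
  refine ((hg.mul_const ((1 + |v|) ^ m * Real.exp (-(1 / 4) * v ^ 2))).const_mul C).mono'
    (continuous_weylKernel_left j k v).aestronglyMeasurable
    (Filter.Eventually.of_forall fun u => h u v)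

theorem sqrt_factor (k d : ℕ) :
    (√(2 ^ (k + d + k) * ((k + d).factorial * k.factorial : ℝ)))⁻¹ * (2 ^ k * k.factorial) =
      √((k.factorial : ℝ) / (2 ^ d * ((k + d).factorial : ℝ))) := by
  have h1 : (2 : ℝ) ^ k * k.factorial = √((2 ^ k * k.factorial) ^ 2) :=
    (Real.sqrt_sq (by positivity)).symm
  rw [h1, ← Real.sqrt_inv, ← Real.sqrt_mul (by positivity)]
  congr 1
  have h0 : (k.factorial : ℝ) ≠ 0 := by positivity
  have h2 : ((k + d).factorial : ℝ) ≠ 0 := by positivity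
  field_simp
  ring

/-- With a = -iu - v and b = -iu + v one has -ab/2 = (u²+v²)/2 = t²/2, the argument of the Laguerre
polynomial, while b^d carries the phase. Changing the sign of v swaps a and b, hence the two
indices. -/
theorem weylKernel_eq_of_le (k d : ℕ) (t : ℝ) (u v : ℝ) (e : ℂ)
    (ht : t ≠ 0) (huv : u ^ 2 + v ^ 2 = t ^ 2) (he : -(Complex.I * u) + v = -Complex.I * t * e) :
    weylKernel (k + d) k u v = (√((k.factorial : ℝ) / (2 ^ d * ((k + d).factorial : ℝ))) *
        Real.exp (-t ^ 2 / 4) * laguerre k d (t ^ 2 / 2) : ℝ) * (-Complex.I * t * e) ^ d ∧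
    weylKernel k (k + d) u (-v) = (√((k.factorial : ℝ) / (2 ^ d * ((k + d).factorial : ℝ))) *
        Real.exp (-t ^ 2 / 4) * laguerre k d (t ^ 2 / 2) : ℝ) * (-Complex.I * t * e) ^ d := by
  have hab : -((-(Complex.I * u) - v) * (-(Complex.I * u) + v)) / 2 = ((t ^ 2 / 2 : ℝ) : ℂ) := by
    rw [← huv]
    push_cast
    linear_combination (-(u : ℂ) ^ 2 / 2) * Complex.I_sq
  have hL := laguerrePoly2_eq_sum k d (-(Complex.I * u) - v) (-(Complex.I * u) + v)
  rw [hab, he] at hL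
  have hl := laguerre_eq_sum k d (x := t ^ 2 / 2) (by positivity)
  have hl' : (laguerre k d (t ^ 2 / 2) : ℂ) = ∑ i ∈ Finset.range (k + 1),
      (-1) ^ i * ((k + d).choose (k - i) : ℂ) * ((t ^ 2 / 2 : ℝ) : ℂ) ^ i / (i.factorial : ℂ) := by
    rw [hl]; push_cast; rfl
  rw [← hl'] at hL
  have hmain : weylKernel (k + d) k u v =
      (√((k.factorial : ℝ) / (2 ^ d * ((k + d).factorial : ℝ))) *
        Real.exp (-t ^ 2 / 4) * laguerre k d (t ^ 2 / 2) : ℝ) * (-Complex.I * t * e) ^ d := by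
    rw [weylKernel, he, hL, huv, ← sqrt_factor]
    push_cast
    ring
  refine ⟨hmain, ?_⟩
  rw [← hmain, weylKernel, weylKernel, laguerrePoly2_comm (k + d) k, add_comm k (k + d),
    mul_comm (k.factorial : ℝ)]
  push_cast
  simp only [neg_sq, sub_eq_add_neg, neg_neg]

/-- The identity behind the pattern functions: they are Weyl matrix elements in polar coordinates,
weighted by the Jacobian |t|. -/
theorem patternFourier_mul_cexp (j k : ℕ) (t φ : ℝ) :
    patternFourier j k t * Complex.exp (-Complex.I * ((k : ℂ) - (j : ℂ)) * (φ : ℂ)) =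
      Real.pi * |t| * weylKernel j k (t * Real.cos φ) (t * Real.sin φ) := by
  rcases eq_or_ne t 0 with rfl | ht
  -- The factor |t| kills both sides, so the value of `laguerre` at 0 is immaterial.
  · simp [patternFourier]
  have hsq : ∀ φ : ℝ, (t * Real.cos φ) ^ 2 + (t * Real.sin φ) ^ 2 = t ^ 2 := by
    intro φ
    rw [mul_pow, mul_pow, ← mul_add, Real.cos_sq_add_sin_sq, mul_one]
  have he : ∀ φ : ℝ, -(Complex.I * (t * Real.cos φ : ℝ)) + (t * Real.sin φ : ℝ) =
      -Complex.I * t * Complex.exp (φ * Complex.I) := by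
    intro φ
    rw [Complex.exp_mul_I, ← Complex.ofReal_cos, ← Complex.ofReal_sin]
    push_cast
    linear_combination ((t : ℂ) * (Complex.sin φ)) * Complex.I_sq
  rcases le_total k j with h | h
  · obtain ⟨d, rfl⟩ := Nat.exists_eq_add_of_le h
    rw [(weylKernel_eq_of_le k d t _ _ _ ht (hsq φ) (he φ)).1]
    simp only [patternFourier, max_eq_left h, min_eq_right h, Nat.add_sub_cancel_left]
    rw [mul_pow, mul_pow, ← Complex.exp_nat_mul]
    rw [show -Complex.I * ((k : ℂ) - ((k + d : ℕ) : ℂ)) * (φ : ℂ) = d * (φ * Complex.I) by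
      push_cast; ring]
    push_cast
    ring
  · obtain ⟨d, rfl⟩ := Nat.exists_eq_add_of_le h
    -- The index swap reverses the sign of v, so the angle must be -φ.
    have h2 := (weylKernel_eq_of_le j d t _ _ _ ht (hsq (-φ)) (he (-φ))).2
    rw [Real.cos_neg, Real.sin_neg, mul_neg, neg_neg] at h2
    rw [h2]
    simp only [patternFourier, max_eq_right h, min_eq_left h, Nat.add_sub_cancel_left]
    rw [mul_pow, mul_pow, ← Complex.exp_nat_mul]
    rw [show -Complex.I * (((j + d : ℕ) : ℂ) - (j : ℂ)) * (φ : ℂ) =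
      d * (((-φ : ℝ) : ℂ) * Complex.I) by push_cast; ring]
    push_cast
    ring

theorem patternFourier_eq (j k : ℕ) (t : ℝ) :
    patternFourier j k t = Real.pi * |t| * weylKernel j k t 0 := by
  simpa using patternFourier_mul_cexp j k t 0

theorem continuous_patternFourier (j k : ℕ) : Continuous (patternFourier j k) := by
  rw [funext (patternFourier_eq j k)]
  have h : Continuous fun t : ℝ => weylKernel j k t 0 := continuous_weylKernel_left j k 0
  exact (continuous_const.mul (Complex.continuous_ofReal.comp continuous_abs)).mul h

/-- The decay e^{-t²/4} of the matrix element absorbs e^{γt²}. Together with `gam_lt`, this is where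
η > 1/2 is needed. -/
theorem integrable_patternFourier_mul_gauss (j k : ℕ) {γ : ℝ} (hγ : γ < 1 / 4) :
    Integrable fun t : ℝ => patternFourier j k t * (Real.exp (γ * t ^ 2) : ℂ) := by
  obtain ⟨C, m, h⟩ := norm_weylKernel_le j k
  have hg := integrable_one_add_abs_pow_mul_gauss (m + 1) (b := 1 / 4 - γ) (by linarith)
  have hC : 0 ≤ C := by
    have := (norm_nonneg _).trans (h 0 0)
    simpa using this
  refine (hg.const_mul (Real.pi * C)).mono' ?_ (Filter.Eventually.of_forall fun t => ?_)
  · have := continuous_patternFourier j k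
    exact Continuous.aestronglyMeasurable (by fun_prop)
  rw [norm_mul, Complex.norm_real, Real.norm_of_nonneg (Real.exp_pos _).le, patternFourier_eq,
    norm_mul, norm_mul, Complex.norm_real, Complex.norm_real, Real.norm_of_nonneg Real.pi_nonneg,
    Real.norm_of_nonneg (abs_nonneg t)]
  have h' := h t 0
  simp only [abs_zero, add_zero, one_pow, ne_eq, OfNat.ofNat_ne_zero, not_false_eq_true, zero_pow,
    mul_zero, Real.exp_zero, mul_one] at h'
  have ht : |t| ≤ 1 + |t| := by linarith
  have key : |t| * ‖weylKernel j k t 0‖ ≤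
      (1 + |t|) * (C * ((1 + |t|) ^ m * Real.exp (-(1 / 4) * t ^ 2))) :=
    mul_le_mul ht h' (norm_nonneg _) (by positivity)
  have hexp : Real.exp (-(1 / 4) * t ^ 2) * Real.exp (γ * t ^ 2) =
      Real.exp (-(1 / 4 - γ) * t ^ 2) := by
    rw [← Real.exp_add]
    congr 1
    ring
  rw [mul_assoc Real.pi, ← hexp]
  refine (mul_le_mul_of_nonneg_right (mul_le_mul_of_nonneg_left key Real.pi_nonneg)
    (Real.exp_pos _).le).trans_eq ?_
  ring

theorem gam_lt {η : ℝ} (hη : 1 / 2 < η) : gam η < 1 / 4 := by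
  rw [gam, div_lt_div_iff₀ (by linarith) (by norm_num)]
  linarith

theorem integrable_patternFourier (j k : ℕ) : Integrable (patternFourier j k) := by
  simpa using integrable_patternFourier_mul_gauss j k (γ := 0) (by norm_num)

open scoped FourierTransform

/-! ### The Fock functions and the Weyl operators -/

theorem fock_eq_polyGauss (j : ℕ) (x : ℝ) : (fock j x : ℂ) =
    ((1 / √(√Real.pi * 2 ^ j * (j.factorial : ℝ)) : ℝ) : ℂ) * polyGauss (hermitePoly j) x := by
  rw [fock, hermiteH_eq, polyGauss]
  push_cast
  ring

theorem continuous_fock (j : ℕ) : Continuous fun x : ℝ => (fock j x : ℂ) := by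
  rw [funext (fock_eq_polyGauss j)]
  exact continuous_const.mul (continuous_polyGauss _)

theorem memLp_comp_add_right {f : ℝ → ℂ} (hf : MemLp f 2 volume) (v : ℝ) :
    MemLp (fun x => f (x + v)) 2 volume :=
  hf.comp_measurePreserving (measurePreserving_add_right (volume : Measure ℝ) v)

theorem integrable_fock_mul (j k : ℕ) (v : ℝ) :
    Integrable fun y : ℝ => (fock j (y + v) : ℂ) * fock k y :=
  (memLp_comp_add_right (memLp_fock j) v).integrable_mul (memLp_fock k)

theorem fock_normalization (j k : ℕ) :
    (1 / √(√Real.pi * 2 ^ j * (j.factorial : ℝ))) * (1 / √(√Real.pi * 2 ^ k * (k.factorial : ℝ))) *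
      √Real.pi = (√(2 ^ (j + k) * (j.factorial * k.factorial : ℝ)))⁻¹ := by
  have hpi : (√Real.pi) = √(√Real.pi ^ 2) := (Real.sqrt_sq (Real.sqrt_nonneg _)).symm
  rw [one_div, one_div, ← Real.sqrt_inv, ← Real.sqrt_inv, ← Real.sqrt_mul (by positivity)]
  nth_rw 3 [hpi]
  rw [← Real.sqrt_mul (by positivity), ← Real.sqrt_inv]
  congr 1
  have h : √Real.pi ≠ 0 := by positivity
  have h1 : (j.factorial : ℝ) ≠ 0 := by positivity
  have h2 : (k.factorial : ℝ) ≠ 0 := by positivity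
  field_simp
  ring

theorem integral_fock_mul (j k : ℕ) (u v : ℝ) :
    ∫ y : ℝ, Complex.exp (-Complex.I * u * y) * ((fock j (y + v) : ℂ) * fock k y) =
      Complex.exp (Complex.I * u * v / 2) * weylKernel j k u v := by
  have h := ambiguity_hermitePoly (-u) v k j
  rw [ambiguity_one_one] at h
  have h1 : ∀ y : ℝ, Complex.exp (-Complex.I * u * y) * ((fock j (y + v) : ℂ) * fock k y) =
      (((1 / √(√Real.pi * 2 ^ j * (j.factorial : ℝ))) *
        (1 / √(√Real.pi * 2 ^ k * (k.factorial : ℝ))) : ℝ) : ℂ) *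
        ambiguityFun (-u) v (hermitePoly k) (hermitePoly j) y := by
    intro y
    rw [fock_eq_polyGauss, fock_eq_polyGauss, ambiguityFun]
    push_cast
    rw [show Complex.I * -(u : ℂ) * y = -Complex.I * u * y by ring]
    ring
  rw [funext h1, integral_const_mul]
  change _ * ambiguity (-u) v (hermitePoly k) (hermitePoly j) = _
  rw [h, weylKernel, ← fock_normalization]
  push_cast
  rw [show -((-(u : ℂ)) ^ 2 + (v : ℂ) ^ 2) / 4 - Complex.I * -(u : ℂ) * v / 2 =
    -((u : ℂ) ^ 2 + (v : ℂ) ^ 2) / 4 + Complex.I * u * v / 2 by ring, Complex.exp_add,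
    mul_neg]
  ring

/-- Fourier inversion in u, at fixed v, of `integral_fock_mul`. The factor 2π comes from rescaling
the frequency to the convention e^{-2πiwy} of `𝓕`. -/
theorem integral_cexp_mul_weylKernel (j k : ℕ) (x v : ℝ) :
    ∫ u : ℝ, Complex.exp (((u * x + u * v / 2 : ℝ) : ℂ) * Complex.I) * weylKernel j k u v =
      2 * Real.pi * ((fock j (x + v) : ℂ) * fock k x) := by
  set g : ℝ → ℂ := fun y => (fock j (y + v) : ℂ) * fock k y with hg
  set K : ℝ → ℂ := fun u => Complex.exp (Complex.I * u * v / 2) * weylKernel j k u v with hK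
  have hFg : 𝓕 g = fun w => K ((2 * Real.pi) * w) := by
    ext w
    rw [Real.fourier_real_eq_integral_exp_smul, hK]
    simp only
    rw [← integral_fock_mul]
    congr 1
    ext y
    rw [smul_eq_mul]
    congr 2
    push_cast
    ring
  have hKi : Integrable K := by
    have h := integrable_weylKernel_left j k v
    refine h.mono ?_ (Filter.Eventually.of_forall fun u => ?_)
    · have := continuous_weylKernel_left j k v
      exact Continuous.aestronglyMeasurable (by fun_prop)
    · rw [hK]
      simp only
      rw [norm_mul, show Complex.I * (u : ℂ) * v / 2 = ((u * v / 2 : ℝ) : ℂ) * Complex.I by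
        push_cast; ring, Complex.norm_exp_ofReal_mul_I, one_mul]
  have hgc : Continuous g := by
    have h1 := continuous_fock j
    have h2 := continuous_fock k
    exact (h1.comp (continuous_add_const v)).mul h2
  have hFi : Integrable (𝓕 g) := by
    rw [hFg]
    exact hKi.comp_mul_left' (by positivity)
  have hinv := congrFun (hgc.fourierInv_fourier_eq (integrable_fock_mul j k v) hFi) x
  rw [Real.fourierInv_eq', hFg] at hinv
  set L : ℝ → ℂ := fun u => Complex.exp (((u * x + u * v / 2 : ℝ) : ℂ) * Complex.I) *
    weylKernel j k u v with hL
  have h1 : ∀ w : ℝ, Complex.exp (((2 * Real.pi * inner ℝ w x : ℝ) : ℂ) * Complex.I) •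
      K ((2 * Real.pi) * w) = L ((2 * Real.pi) * w) := by
    intro w
    simp only [hK, hL, smul_eq_mul]
    rw [← mul_assoc, ← Complex.exp_add]
    congr 2
    simp only [RCLike.inner_apply, conj_trivial]
    push_cast
    ring
  rw [funext h1, Measure.integral_comp_mul_left, abs_of_pos (by positivity)] at hinv
  have h2 : ∫ u, L u = 2 * Real.pi * g x := by
    rw [← hinv, Complex.real_smul]
    have : (Real.pi : ℂ) ≠ 0 := by exact_mod_cast Real.pi_ne_zero
    push_cast
    field_simp
  exact h2

theorem coeFn_weyl (u v : ℝ) (g : H) : weyl u v g =ᵐ[volume] weylFun u v g :=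
  (memLp_weylFun u v g).coeFn_toLp

theorem norm_weyl (u v : ℝ) (g : H) : ‖weyl u v g‖ = ‖g‖ := by
  change ‖(memLp_weylFun u v g).toLp _‖ = ‖g‖
  rw [Lp.norm_toLp, eLpNorm_weylFun, Lp.norm_def]

theorem inner_weyl_eq (u v : ℝ) (a b : H) : inner ℂ a (weyl u v b) =
    ∫ x : ℝ, (starRingEnd ℂ) (a x) * b (x + v) *
      Complex.exp (((u * x + u * v / 2 : ℝ) : ℂ) * Complex.I) := by
  rw [L2.inner_def]
  refine integral_congr_ae ?_
  filter_upwards [coeFn_weyl u v b] with x hx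
  rw [hx, weylFun, RCLike.inner_apply]
  ring

theorem stronglyMeasurable_inner_weyl (a b : H) :
    StronglyMeasurable fun z : ℝ × ℝ => inner ℂ a (weyl z.1 z.2 b) := by
  simp only [inner_weyl_eq]
  refine StronglyMeasurable.integral_prod_right (f := fun (z : ℝ × ℝ) (x : ℝ) =>
    (starRingEnd ℂ) (a x) * b (x + z.2) *
      Complex.exp (((z.1 * x + z.1 * z.2 / 2 : ℝ) : ℂ) * Complex.I)) ?_
  have ha : StronglyMeasurable fun w : (ℝ × ℝ) × ℝ => (starRingEnd ℂ) (a w.2) :=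
    Complex.continuous_conj.comp_stronglyMeasurable
      ((Lp.stronglyMeasurable a).comp_measurable measurable_snd)
  have hb : StronglyMeasurable fun w : (ℝ × ℝ) × ℝ => b (w.2 + w.1.2) :=
    (Lp.stronglyMeasurable b).comp_measurable (by fun_prop)
  have hc : Continuous fun w : (ℝ × ℝ) × ℝ =>
      Complex.exp (((w.1.1 * w.2 + w.1.1 * w.1.2 / 2 : ℝ) : ℂ) * Complex.I) := by fun_prop
  exact (ha.mul hb).mul hc.stronglyMeasurable

theorem norm_inner_weyl_le (u v : ℝ) (a b : H) : ‖inner ℂ a (weyl u v b)‖ ≤ ‖a‖ * ‖b‖ := by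
  have h := norm_inner_le_norm (𝕜 := ℂ) a (weyl u v b)
  rwa [norm_weyl] at h

theorem integrable_inner_weyl_mul_weylKernel (a b : H) (j k : ℕ) :
    Integrable fun z : ℝ × ℝ => inner ℂ a (weyl z.1 z.2 b) * weylKernel j k z.1 z.2 :=
  (integrable_weylKernel j k).bdd_mul (stronglyMeasurable_inner_weyl a b).aestronglyMeasurable
    (Filter.Eventually.of_forall fun z => norm_inner_weyl_le z.1 z.2 a b)

theorem memLp_conj (a : H) : MemLp (fun x : ℝ => (starRingEnd ℂ) (a x)) 2 volume :=
  (Lp.memLp a).star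

theorem inner_fockVec_right (a : H) (k : ℕ) :
    inner ℂ a (fockVec k) = ∫ x : ℝ, (starRingEnd ℂ) (a x) * fock k x := by
  rw [L2.inner_def]
  refine integral_congr_ae ?_
  filter_upwards [(memLp_fock k).coeFn_toLp] with x hx
  rw [fockVec, hx, RCLike.inner_apply, mul_comm]

theorem inner_fockVec_left (b : H) (j : ℕ) :
    inner ℂ (fockVec j) b = ∫ x : ℝ, b x * fock j x := by
  rw [L2.inner_def]
  refine integral_congr_ae ?_
  filter_upwards [(memLp_fock j).coeFn_toLp] with x hx
  rw [fockVec, hx, RCLike.inner_apply, Complex.conj_ofReal]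

theorem integral_inner_weyl_mul_weylKernel_left (a b : H) (j k : ℕ) (v : ℝ) :
    ∫ u : ℝ, inner ℂ a (weyl u v b) * weylKernel j k u v =
      2 * Real.pi * ∫ x : ℝ, ((starRingEnd ℂ) (a x) * fock k x) * (b (x + v) * fock j (x + v)) := by
  have hab : Integrable fun x : ℝ => (starRingEnd ℂ) (a x) * b (x + v) :=
    (memLp_conj a).integrable_mul (memLp_comp_add_right (Lp.memLp b) v)
  have hprod := (integrable_weylKernel_left j k v).mul_prod hab
  have hc : Continuous fun w : ℝ × ℝ =>
      Complex.exp (((w.1 * w.2 + w.1 * v / 2 : ℝ) : ℂ) * Complex.I) := by fun_prop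
  have hint : Integrable (Function.uncurry fun u x : ℝ => (starRingEnd ℂ) (a x) * b (x + v) *
      (Complex.exp (((u * x + u * v / 2 : ℝ) : ℂ) * Complex.I) * weylKernel j k u v))
      (volume.prod volume) := by
    refine (hprod.bdd_mul (c := 1) hc.aestronglyMeasurable
      (Filter.Eventually.of_forall fun w => ?_)).congr (Filter.Eventually.of_forall fun w => ?_)
    · rw [Complex.norm_exp_ofReal_mul_I]
    · simp only [Function.uncurry]
      ring
  calc _ = ∫ u : ℝ, ∫ x : ℝ, (starRingEnd ℂ) (a x) * b (x + v) *
      (Complex.exp (((u * x + u * v / 2 : ℝ) : ℂ) * Complex.I) * weylKernel j k u v) := by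
        congr 1
        ext u
        rw [inner_weyl_eq, ← integral_mul_const]
        congr 1
        ext x
        ring
    _ = ∫ x : ℝ, ∫ u : ℝ, (starRingEnd ℂ) (a x) * b (x + v) *
      (Complex.exp (((u * x + u * v / 2 : ℝ) : ℂ) * Complex.I) * weylKernel j k u v) :=
        integral_integral_swap hint
    _ = _ := by
        rw [← integral_const_mul]
        congr 1
        ext x
        rw [integral_const_mul, integral_cexp_mul_weylKernel]
        ring

/-- **Orthogonality relation** (Moyal's identity) for the Weyl operators. -/
theorem integral_inner_weyl_mul_weylKernel (a b : H) (j k : ℕ) :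
    ∫ z : ℝ × ℝ, inner ℂ a (weyl z.1 z.2 b) * weylKernel j k z.1 z.2 =
      2 * Real.pi * (inner ℂ a (fockVec k) * inner ℂ (fockVec j) b) := by
  have hf : Integrable fun x : ℝ => (starRingEnd ℂ) (a x) * fock k x :=
    (memLp_conj a).integrable_mul (memLp_fock k)
  have hg : Integrable fun x : ℝ => b x * fock j x :=
    (Lp.memLp b).integrable_mul (memLp_fock j)
  -- The shear (x, v) ↦ (x, x + v) preserves Lebesgue measure and turns a product of functions of
  -- separate variables into this integrand.
  have hint : Integrable (fun w : ℝ × ℝ => ((starRingEnd ℂ) (a w.1) * fock k w.1) *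
      (b (w.1 + w.2) * fock j (w.1 + w.2))) (volume.prod volume) :=
    (measurePreserving_prod_add (volume : Measure ℝ) (volume : Measure ℝ)).integrable_comp_of_integrable
      (hf.mul_prod hg)
  rw [Measure.volume_eq_prod, integral_prod_symm _ (by
    rw [← Measure.volume_eq_prod]; exact integrable_inner_weyl_mul_weylKernel a b j k)]
  simp only [integral_inner_weyl_mul_weylKernel_left]
  rw [integral_const_mul, ← integral_integral_swap hint]
  congr 1
  rw [inner_fockVec_right, inner_fockVec_left, ← integral_mul_const]
  congr 1
  ext x
  rw [integral_const_mul, integral_add_left_eq_self (μ := volume) (fun y => b y * (fock j y : ℂ)) x]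

/-! ### Reconstruction of the density matrix -/

/-- Orthonormal vectors are √2 apart, so the balls of radius 1/2 around them are disjoint open sets
in a separable space. Countability permits dominated convergence for sums over a basis. -/
theorem _root_.Orthonormal.countable {𝕜 E ι : Type*} [RCLike 𝕜] [NormedAddCommGroup E]
    [InnerProductSpace 𝕜 E] [TopologicalSpace.SeparableSpace E] {v : ι → E}
    (hv : Orthonormal 𝕜 v) : Countable ι := by
  have hd : Pairwise (Function.onFun Disjoint fun i => Metric.ball (v i) (1 / 2)) := by
    intro i j hij
    refine Metric.ball_disjoint_ball ?_
    have h1 : ‖v i - v j‖ ^ 2 = 2 := by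
      rw [@norm_sub_sq 𝕜, hv.1 i, hv.1 j, hv.2 hij]
      norm_num
    rw [dist_eq_norm]
    nlinarith [norm_nonneg (v i - v j)]
  exact hd.countable_of_isOpen_disjoint (fun _ => Metric.isOpen_ball)
    fun i => ⟨v i, Metric.mem_ball_self (by norm_num)⟩

theorem weyl_weyl_neg (u v : ℝ) (g : H) : weyl u v (weyl (-u) (-v) g) = g := by
  refine Lp.ext ?_
  filter_upwards [coeFn_weyl u v (weyl (-u) (-v) g), ae_shift v (coeFn_weyl (-u) (-v) g)]
    with x h1 h2
  rw [h1, weylFun, h2, weylFun, ← mul_assoc, ← Complex.exp_add, add_neg_cancel_right]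
  have : ((u * x + u * v / 2 : ℝ) : ℂ) * Complex.I +
      ((-u * (x + v) + -u * -v / 2 : ℝ) : ℂ) * Complex.I = 0 := by
    push_cast
    ring
  rw [this, Complex.exp_zero, one_mul]

/-- The Weyl operator as a unitary operator. -/
def weylEquiv (u v : ℝ) : H ≃ₗᵢ[ℂ] H :=
  LinearIsometryEquiv.ofSurjective
    { toLinearMap := (weyl u v).toLinearMap, norm_map' := norm_weyl u v }
    fun g => ⟨weyl (-u) (-v) g, weyl_weyl_neg u v g⟩

theorem weylEquiv_apply (u v : ℝ) (g : H) : weylEquiv u v g = weyl u v g := rfl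

/-- The image of a Hilbert basis under a Weyl operator. -/
def weylBasis {ι : Type} (b : HilbertBasis ι ℂ H) (u v : ℝ) : HilbertBasis ι ℂ H :=
  HilbertBasis.ofRepr ((weylEquiv u v).symm.trans b.repr)

theorem weylBasis_apply {ι : Type} (b : HilbertBasis ι ℂ H) (u v : ℝ) (i : ι) :
    weylBasis b u v i = weyl u v (b i) := by
  classical
  rw [← weylEquiv_apply, ← HilbertBasis.repr_symm_single, ← HilbertBasis.repr_symm_single]
  rfl

/-- Expand ⟨x - cy, T(x - cy)⟩ ≥ 0 with the phase c that makes c⟨x, Ty⟩ equal to its modulus. The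
arithmetic mean, instead of the geometric mean of Cauchy–Schwarz, sums directly to traces. -/
theorem _root_.ContinuousLinearMap.IsPositive.norm_inner_le {E : Type*} [NormedAddCommGroup E]
    [InnerProductSpace ℂ E] {T : E →L[ℂ] E} (hT : T.IsPositive) (x y : E) :
    ‖inner ℂ x (T y)‖ ≤ ((inner ℂ x (T x)).re + (inner ℂ y (T y)).re) / 2 := by
  have hsym : ∀ x y : E, inner ℂ (T x) y = inner ℂ x (T y) := hT.1
  have key : ∀ c : ℂ, ‖c‖ = 1 → 2 * (c * inner ℂ x (T y)).re ≤
      (inner ℂ x (T x)).re + (inner ℂ y (T y)).re := by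
    intro c hc
    have h := hT.2 (x - c • y)
    rw [ContinuousLinearMap.reApplyInnerSelf_apply, hsym, map_sub, map_smul, inner_sub_left,
      inner_sub_right, inner_sub_right, inner_smul_left, inner_smul_right, inner_smul_right,
      inner_smul_left] at h
    have h1 : inner ℂ y (T x) = (starRingEnd ℂ) (inner ℂ x (T y)) := by
      rw [← hsym, inner_conj_symm]
    have h2 : c * ((starRingEnd ℂ) c * inner ℂ y (T y)) = inner ℂ y (T y) := by
      rw [← mul_assoc, Complex.mul_conj, Complex.normSq_eq_norm_sq, hc]
      simp
    rw [h1, h2, ← map_mul] at h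
    simp only [map_sub, RCLike.re_to_complex, Complex.conj_re] at h
    linarith
  set z : ℂ := inner ℂ x (T y) with hz
  rcases eq_or_ne z 0 with h0 | h0
  · have := key 1 (by simp)
    rw [h0] at this ⊢
    simp only [mul_zero, Complex.zero_re, norm_zero] at this ⊢
    linarith
  · have hn : (‖z‖ : ℂ) ≠ 0 := by exact_mod_cast norm_ne_zero_iff.mpr h0
    have h := key ((starRingEnd ℂ) z / ‖z‖) (by
      rw [norm_div, RCLike.norm_conj, Complex.norm_real, norm_norm, div_self]
      exact norm_ne_zero_iff.mpr h0)
    have h1 : (starRingEnd ℂ) z / ‖z‖ * z = (‖z‖ : ℂ) := by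
      rw [div_mul_eq_mul_div, mul_comm, Complex.mul_conj, Complex.normSq_eq_norm_sq]
      push_cast
      field_simp
    rw [h1, Complex.ofReal_re] at h
    linarith

/-- Expand the trace in a basis, apply Moyal's identity to each term and resum by Parseval. For the
exchange of sum and integral, the terms are dominated by diagonal elements of ρ in the basis and in
its image under the Weyl operator. Both families sum to 1, which leaves the integrable bound
‖`weylKernel`‖. -/
theorem integral_trace_mul_weylKernel {ρ : H →L[ℂ] H} (hρ : IsQuantumState ρ) {χ : ℝ × ℝ → ℂ}
    (hχ : ∀ z : ℝ × ℝ, HasTrace (ρ ∘L weyl z.1 z.2) (χ z)) (j k : ℕ) :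
    ∫ z : ℝ × ℝ, χ z * weylKernel j k z.1 z.2 = 2 * Real.pi * densityMatrix ρ (j, k) := by
  obtain ⟨w, b, hb⟩ := exists_hilbertBasis ℂ H
  have : Fact ((2 : ℝ≥0∞) ≠ ∞) := ⟨by simp⟩
  have : Countable w := b.orthonormal.countable
  have hsym : ∀ x y : H, inner ℂ (ρ x) y = inner ℂ x (ρ y) := hρ.positive.1
  have hre : ∀ B : HilbertBasis w ℂ H, HasSum (fun i => (inner ℂ (B i) (ρ (B i))).re) 1 := by
    intro B
    simpa using Complex.hasSum_re (hρ.trace_one w B)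
  have hbd : ∀ z : ℝ × ℝ, HasSum (fun i => ((inner ℂ (b i) (ρ (b i))).re +
      (inner ℂ (weyl z.1 z.2 (b i)) (ρ (weyl z.1 z.2 (b i)))).re) / 2 *
        ‖weylKernel j k z.1 z.2‖) ‖weylKernel j k z.1 z.2‖ := by
    intro z
    have h2 := hre (weylBasis b z.1 z.2)
    simp only [weylBasis_apply] at h2
    simpa using (((hre b).add h2).div_const 2).mul_right ‖weylKernel j k z.1 z.2‖
  have hsum := hasSum_integral_of_dominated_convergence (μ := (volume : Measure (ℝ × ℝ)))
    (F := fun (i : w) z => inner ℂ (ρ (b i)) (weyl z.1 z.2 (b i)) * weylKernel j k z.1 z.2)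
    (f := fun z => χ z * weylKernel j k z.1 z.2) _
    (fun i => (integrable_inner_weyl_mul_weylKernel _ _ j k).aestronglyMeasurable)
    (fun i => Filter.Eventually.of_forall fun z => by
      rw [norm_mul, hsym]
      exact mul_le_mul_of_nonneg_right (hρ.positive.norm_inner_le _ _) (norm_nonneg _))
    (Filter.Eventually.of_forall fun z => (hbd z).summable)
    (by simpa only [(hbd _).tsum_eq] using (integrable_weylKernel j k).norm)
    (Filter.Eventually.of_forall fun z => by
      have h := (hχ z w b).mul_right (weylKernel j k z.1 z.2)
      simp only [hsym]
      exact h)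
  simp only [integral_inner_weyl_mul_weylKernel] at hsum
  have h2 := (b.hasSum_inner_mul_inner (fockVec j) (ρ (fockVec k))).mul_left (2 * Real.pi : ℂ)
  refine hsum.unique ?_
  convert! h2 using 2 with i
  rw [hsym, mul_comm (inner ℂ (fockVec j) (b i))]

/-! ### Rotations of the plane and the Radon transform -/

/-- The rotation of the plane by the angle `φ`. -/
def rot (φ : ℝ) (z : ℝ × ℝ) : ℝ × ℝ :=
  (z.1 * Real.cos φ - z.2 * Real.sin φ, z.1 * Real.sin φ + z.2 * Real.cos φ)

theorem measurable_rot : Measurable (Function.uncurry rot) := by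
  have : Continuous (Function.uncurry rot) := by
    unfold Function.uncurry rot
    fun_prop
  exact this.measurable

theorem measurePreserving_rot (φ : ℝ) : MeasurePreserving (rot φ) volume volume := by
  have h := (Complex.volume_preserving_equiv_real_prod.comp
    (rotation (Circle.exp φ)).measurePreserving).comp
      Complex.volume_preserving_equiv_real_prod.symm
  have heq : rot φ = (Complex.measurableEquivRealProd ∘ rotation (Circle.exp φ)) ∘
      Complex.measurableEquivRealProd.symm := by
    ext z
    · simp [rot, Complex.measurableEquivRealProd_apply,
        Complex.measurableEquivRealProd_symm_apply, Complex.exp_ofReal_mul_I_re,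
        Complex.exp_ofReal_mul_I_im]
      ring
    · simp [rot, Complex.measurableEquivRealProd_apply,
        Complex.measurableEquivRealProd_symm_apply, Complex.exp_ofReal_mul_I_re,
        Complex.exp_ofReal_mul_I_im]
      ring
  rwa [← heq] at h

theorem rot_fst_mul_cos_add (φ : ℝ) (z : ℝ × ℝ) :
    (rot φ z).1 * Real.cos φ + (rot φ z).2 * Real.sin φ = z.1 := by
  simp only [rot]
  linear_combination z.1 * Real.cos_sq_add_sin_sq φ

/-- Lebesgue measure on `[0, π]`. -/
def angleMeasure : Measure ℝ := volume.restrict (Set.Icc 0 Real.pi)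

instance : IsFiniteMeasure angleMeasure := by
  unfold angleMeasure
  infer_instance

theorem angleMeasure_real_univ : angleMeasure.real Set.univ = Real.pi := by
  simp [angleMeasure, Measure.real, Real.pi_nonneg]

theorem volume_restrict_univ_prod :
    (volume : Measure (ℝ × ℝ)).restrict (Set.univ ×ˢ Set.Icc 0 Real.pi) =
      (volume : Measure ℝ).prod angleMeasure := by
  rw [angleMeasure, Measure.volume_eq_prod, ← Measure.prod_restrict, Measure.restrict_univ]

theorem integrable_comp_rot {W : ℝ × ℝ → ℝ} (hW : Integrable W) :
    Integrable (fun p : ℝ × (ℝ × ℝ) => W (rot p.1 p.2)) (angleMeasure.prod volume) := by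
  have hmp : MeasurePreserving (fun p : ℝ × (ℝ × ℝ) => (p.1, rot p.1 p.2))
      (angleMeasure.prod volume) (angleMeasure.prod volume) :=
    (MeasurePreserving.id angleMeasure).skew_product measurable_rot
      (Filter.Eventually.of_forall fun φ => (measurePreserving_rot φ).map_eq)
  exact hmp.integrable_comp_of_integrable (hW.comp_snd angleMeasure)

theorem integrable_radon {W : ℝ × ℝ → ℝ} (hW : Integrable W) :
    Integrable (fun z : ℝ × ℝ => radon W z.1 z.2) ((volume : Measure ℝ).prod angleMeasure) := by
  have h : Integrable (fun p : (ℝ × ℝ) × ℝ => W (rot p.1.1 (p.1.2, p.2)))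
      ((angleMeasure.prod volume).prod volume) :=
    (measurePreserving_prodAssoc angleMeasure (volume : Measure ℝ)
      (volume : Measure ℝ)).integrable_comp_of_integrable (integrable_comp_rot hW)
  exact h.integral_prod_left.swap

/-- At a fixed angle, (x, t) are rotated coordinates of the plane and x = q cos φ + p sin φ;
rotations preserve Lebesgue measure. -/
theorem integral_radon_mul {W : ℝ × ℝ → ℝ} (hW : Integrable W) {h : ℝ × ℝ → ℂ}
    (hc : Continuous h) {C : ℝ} (hC : ∀ z, ‖h z‖ ≤ C) :
    ∫ z : ℝ × ℝ, (radon W z.1 z.2 : ℂ) * h z ∂((volume : Measure ℝ).prod angleMeasure) =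
      ∫ φ, (∫ y : ℝ × ℝ, (W y : ℂ) * h (y.1 * Real.cos φ + y.2 * Real.sin φ, φ)) ∂angleMeasure := by
  have hint : Integrable (fun z : ℝ × ℝ => (radon W z.1 z.2 : ℂ) * h z)
      ((volume : Measure ℝ).prod angleMeasure) :=
    (integrable_radon hW).ofReal.mul_bdd (c := C) hc.aestronglyMeasurable
      (Filter.Eventually.of_forall hC)
  rw [integral_prod_symm _ hint]
  congr 1
  ext φ
  have hW1 : Integrable (fun z : ℝ × ℝ => (W (rot φ z) : ℂ)) :=
    ((measurePreserving_rot φ).integrable_comp_of_integrable hW).ofReal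
  have hc1 : Continuous fun z : ℝ × ℝ => h (z.1, φ) := by fun_prop
  have hint2 : Integrable (fun z : ℝ × ℝ => (W (rot φ z) : ℂ) * h (z.1, φ))
      (volume.prod volume) :=
    hW1.mul_bdd (c := C) hc1.aestronglyMeasurable (Filter.Eventually.of_forall fun z => hC _)
  calc _ = ∫ x : ℝ, ∫ t : ℝ, (W (rot φ (x, t)) : ℂ) * h (x, φ) := by
        congr 1
        ext x
        rw [integral_mul_const]
        congr 1
        exact integral_ofReal.symm
    _ = ∫ z : ℝ × ℝ, (W (rot φ z) : ℂ) * h (z.1, φ) := (integral_prod _ hint2).symm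
    _ = ∫ z : ℝ × ℝ, (fun y : ℝ × ℝ => (W y : ℂ) *
          h (y.1 * Real.cos φ + y.2 * Real.sin φ, φ)) (rot φ z) := by
        simp only [rot_fst_mul_cos_add]
    _ = _ := by
        have hm : AEStronglyMeasurable (fun y : ℝ × ℝ => (W y : ℂ) *
            h (y.1 * Real.cos φ + y.2 * Real.sin φ, φ)) volume := by
          have hc2 : Continuous fun y : ℝ × ℝ =>
            h (y.1 * Real.cos φ + y.2 * Real.sin φ, φ) := by fun_prop
          exact hW.ofReal.aestronglyMeasurable.mul hc2.aestronglyMeasurable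
        have hmap := (measurePreserving_rot φ).map_eq
        have := integral_map (measurePreserving_rot φ).measurable.aemeasurable (by rwa [hmap])
        rw [← this, hmap]

/-! ### The law of an ideal observation -/

theorem weyl_zero : weyl 0 0 = ContinuousLinearMap.id ℂ H := by
  ext1 g
  refine Lp.ext ?_
  filter_upwards [coeFn_weyl 0 0 g] with x hx
  rw [hx]
  simp [weylFun]

theorem HasTrace.unique {A : H →L[ℂ] H} {c d : ℂ} (hc : HasTrace A c) (hd : HasTrace A d) :
    c = d := by
  obtain ⟨w, b, -⟩ := exists_hilbertBasis ℂ H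
  exact (hc w b).unique (hd w b)

theorem IsWignerFunction.integral_eq_one {ρ : H →L[ℂ] H} {W : ℝ × ℝ → ℝ}
    (hW : IsWignerFunction ρ W) (hρ : IsQuantumState ρ) : ∫ y, (W y : ℂ) = 1 := by
  have h := hW.fourier 0 0
  rw [weyl_zero, ContinuousLinearMap.comp_id] at h
  simpa using h.unique hρ.trace_one

theorem integral_radon_eq_pi {ρ : H →L[ℂ] H} {W : ℝ × ℝ → ℝ}
    (hW : IsWignerFunction ρ W) (hρ : IsQuantumState ρ) :
    ∫ z : ℝ × ℝ, radon W z.1 z.2 ∂((volume : Measure ℝ).prod angleMeasure) = Real.pi := by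
  have h := integral_radon_mul hW.integrable (h := fun _ => 1) continuous_const
    (C := 1) (by simp)
  simp only [mul_one, hW.integral_eq_one hρ, integral_const, angleMeasure_real_univ] at h
  have h' : ((∫ z : ℝ × ℝ, radon W z.1 z.2 ∂((volume : Measure ℝ).prod angleMeasure) : ℝ) : ℂ) =
    (Real.pi : ℂ) := by
    refine integral_ofReal.symm.trans (h.trans ?_)
    simp
  exact_mod_cast h'

theorem idealLaw_eq (W : ℝ × ℝ → ℝ) : idealLaw W =
    ((volume : Measure ℝ).prod angleMeasure).withDensity
      (fun z => ENNReal.ofReal (1 / Real.pi * radon W z.1 z.2)) := by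
  rw [idealLaw, volume_restrict_univ_prod]

/-- `idealLaw` sees only the positive part of the density and has mass 1. The signed density also
has integral 1, because Tr ρ = 1. Hence the negative part has integral zero. -/
theorem radon_nonneg {ρ : H →L[ℂ] H} {W : ℝ × ℝ → ℝ}
    (hW : IsWignerFunction ρ W) (hρ : IsQuantumState ρ) [IsProbabilityMeasure (idealLaw W)] :
    ∀ᵐ z ∂((volume : Measure ℝ).prod angleMeasure), 0 ≤ radon W z.1 z.2 := by
  have hint := (integrable_radon hW.integrable).const_mul (1 / Real.pi)
  have h1 : ∫⁻ z : ℝ × ℝ, ENNReal.ofReal (1 / Real.pi * radon W z.1 z.2)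
      ∂((volume : Measure ℝ).prod angleMeasure) = 1 := by
    have := measure_univ (μ := idealLaw W)
    rwa [idealLaw_eq, withDensity_apply _ MeasurableSet.univ, Measure.restrict_univ] at this
  have h2 := integral_eq_lintegral_pos_part_sub_lintegral_neg_part hint
  rw [h1, integral_const_mul, integral_radon_eq_pi hW hρ,
    one_div_mul_cancel Real.pi_ne_zero, ENNReal.toReal_one] at h2
  have h3 : ∫⁻ z : ℝ × ℝ, ENNReal.ofReal (-(1 / Real.pi * radon W z.1 z.2))
      ∂((volume : Measure ℝ).prod angleMeasure) = 0 := by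
    have hfin : ∫⁻ z : ℝ × ℝ, ENNReal.ofReal (-(1 / Real.pi * radon W z.1 z.2))
      ∂((volume : Measure ℝ).prod angleMeasure) ≠ ∞ := hint.neg.lintegral_lt_top.ne
    have h4 := (ENNReal.toReal_eq_zero_iff _).mp (by linarith : (∫⁻ z : ℝ × ℝ,
      ENNReal.ofReal (-(1 / Real.pi * radon W z.1 z.2))
        ∂((volume : Measure ℝ).prod angleMeasure)).toReal = 0)
    exact h4.resolve_right hfin
  have h5 := (lintegral_eq_zero_iff'
    hint.neg.aestronglyMeasurable.aemeasurable.ennreal_ofReal).mp h3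
  filter_upwards [h5] with z hz
  have hz' : -(1 / Real.pi * radon W z.1 z.2) ≤ 0 := ENNReal.ofReal_eq_zero.mp hz
  have hpi := Real.pi_pos
  by_contra! hneg
  have : 1 / Real.pi * radon W z.1 z.2 < 0 := mul_neg_of_pos_of_neg (by positivity) hneg
  linarith

theorem integral_idealLaw {ρ : H →L[ℂ] H} {W : ℝ × ℝ → ℝ}
    (hW : IsWignerFunction ρ W) (hρ : IsQuantumState ρ) [IsProbabilityMeasure (idealLaw W)]
    {h : ℝ × ℝ → ℂ} (hc : Continuous h) {C : ℝ} (hC : ∀ z, ‖h z‖ ≤ C) :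
    ∫ z, h z ∂(idealLaw W) = 1 / Real.pi * ∫ φ, (∫ y : ℝ × ℝ, (W y : ℂ) *
      h (y.1 * Real.cos φ + y.2 * Real.sin φ, φ)) ∂angleMeasure := by
  rw [idealLaw_eq, integral_withDensity_eq_integral_toReal_smul₀
    ((integrable_radon hW.integrable).const_mul _).aestronglyMeasurable.aemeasurable.ennreal_ofReal
    (by simp), ← integral_radon_mul hW.integrable hc hC, ← integral_const_mul]
  refine integral_congr_ae ?_
  filter_upwards [radon_nonneg hW hρ] with z hz
  rw [ENNReal.toReal_ofReal (mul_nonneg (by positivity) hz), Complex.real_smul]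
  push_cast
  ring

/-! ### Integration in polar coordinates over `ℝ × [0, π]` -/

/-- A point with t < 0 at angle φ has radius -t and angle φ - π. So ℝ × [0, π] covers the plane once
up to a null set, just as (0, ∞) × (-π, π] does. -/
theorem integral_abs_mul_polar {F : ℝ × ℝ → ℂ}
    (hF : Integrable (fun w : ℝ × ℝ => ((|w.2| : ℝ) : ℂ) * F (w.2 * Real.cos w.1, w.2 * Real.sin w.1))
      ((volume.restrict (Set.Ioc (-Real.pi) Real.pi)).prod volume)) :
    ∫ φ, (∫ t : ℝ, ((|t| : ℝ) : ℂ) * F (t * Real.cos φ, t * Real.sin φ)) ∂angleMeasure =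
      ∫ z, F z := by
  set f : ℝ → ℝ → ℂ := fun φ t => ((|t| : ℝ) : ℂ) * F (t * Real.cos φ, t * Real.sin φ) with hf
  set m : ℝ → ℂ := fun φ => ∫ t in Set.Ioi 0, f φ t with hm
  have hpi := Real.pi_pos
  have hpos : Integrable (fun w : ℝ × ℝ => f w.1 w.2)
      ((volume.restrict (Set.Ioc (-Real.pi) Real.pi)).prod (volume.restrict (Set.Ioi 0))) := by
    refine hF.mono_measure ?_
    exact Measure.prod_mono le_rfl Measure.restrict_le_self
  have hmi : IntegrableOn m (Set.Ioc (-Real.pi) Real.pi) := hpos.integral_prod_left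
  have hneg : ∀ φ t, f φ (-t) = f (φ - Real.pi) t := by
    intro φ t
    simp only [hf, abs_neg, Real.cos_sub_pi, Real.sin_sub_pi, mul_neg, neg_mul]
  have hsplit : ∀ᵐ φ ∂(volume.restrict (Set.Ioc (-Real.pi) Real.pi)),
      ∫ t, f φ t = m φ + m (φ - Real.pi) := by
    filter_upwards [hF.prod_right_ae] with φ hφ
    have h1 : ∫ t in Set.Iic 0, f φ t = m (φ - Real.pi) := by
      have h2 := integral_comp_neg_Ioi 0 (f φ)
      rw [neg_zero] at h2
      simp only [hm, ← hneg, h2]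
    rw [← integral_add_compl (measurableSet_Ioi (a := (0 : ℝ))) hφ, Set.compl_Ioi, h1]
  have hmI : IntervalIntegrable m volume (-Real.pi) Real.pi :=
    (intervalIntegrable_iff_integrableOn_Ioc_of_le (by linarith)).mpr hmi
  have hm1 : IntervalIntegrable m volume (-Real.pi) 0 := hmI.mono_set (by
    rw [Set.uIcc_of_le (by linarith), Set.uIcc_of_le (by linarith)]
    exact Set.Icc_subset_Icc le_rfl hpi.le)
  have hm2 : IntervalIntegrable m volume 0 Real.pi := hmI.mono_set (by
    rw [Set.uIcc_of_le (by linarith), Set.uIcc_of_le (by linarith)]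
    exact Set.Icc_subset_Icc (by linarith) le_rfl)
  have hm3 : IntervalIntegrable (fun φ => m (φ - Real.pi)) volume 0 Real.pi := by
    simpa using hm1.comp_sub_right Real.pi
  have hleft : ∫ φ, (∫ t : ℝ, f φ t) ∂angleMeasure = ∫ φ in -Real.pi..Real.pi, m φ := by
    calc _ = ∫ φ in Set.Ioc 0 Real.pi, ∫ t : ℝ, f φ t := by
          rw [angleMeasure, integral_Icc_eq_integral_Ioc]
      _ = ∫ φ in Set.Ioc 0 Real.pi, (m φ + m (φ - Real.pi)) :=
          integral_congr_ae (ae_mono (Measure.restrict_mono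
            (Set.Ioc_subset_Ioc (by linarith) le_rfl) le_rfl) hsplit)
      _ = ∫ φ in 0..Real.pi, (m φ + m (φ - Real.pi)) :=
          (intervalIntegral.integral_of_le hpi.le).symm
      _ = (∫ φ in 0..Real.pi, m φ) + ∫ φ in -Real.pi..0, m φ := by
          rw [intervalIntegral.integral_add hm2 hm3, intervalIntegral.integral_comp_sub_right]
          simp
      _ = _ := by
          rw [add_comm, intervalIntegral.integral_add_adjacent_intervals hm1 hm2]
  have htarget : (volume : Measure (ℝ × ℝ)).restrict polarCoord.target =
      (volume.restrict (Set.Ioi 0)).prod (volume.restrict (Set.Ioc (-Real.pi) Real.pi)) := by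
    rw [polarCoord_target, Measure.volume_eq_prod, ← Measure.prod_restrict,
      restrict_Ioo_eq_restrict_Ioc]
  have hright : ∫ z, F z = ∫ φ in -Real.pi..Real.pi, m φ := by
    rw [intervalIntegral.integral_of_le (by linarith), ← integral_comp_polarCoord_symm, htarget]
    have h1 : ∫ p : ℝ × ℝ, p.1 • F (polarCoord.symm p)
        ∂((volume.restrict (Set.Ioi 0)).prod (volume.restrict (Set.Ioc (-Real.pi) Real.pi))) =
        ∫ p : ℝ × ℝ, f p.2 p.1
        ∂((volume.restrict (Set.Ioi 0)).prod (volume.restrict (Set.Ioc (-Real.pi) Real.pi))) := by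
      rw [← htarget]
      refine setIntegral_congr_fun polarCoord.open_target.measurableSet fun p hp => ?_
      rw [polarCoord_target] at hp
      simp only [hf, polarCoord_symm_apply, abs_of_pos (show 0 < p.1 from hp.1), Complex.real_smul]
    exact h1.trans (integral_prod_symm _ hpos.swap)
  rw [hleft, hright]

/-! ### Unbiasedness of the adapted pattern functions -/

theorem norm_cexp_mul_I_mul (r : ℝ) (c : ℂ) : ‖Complex.exp ((r : ℂ) * Complex.I) * c‖ = ‖c‖ := by
  rw [norm_mul, Complex.norm_exp_ofReal_mul_I, one_mul]

theorem continuous_integral_cexp_mul {g : ℝ → ℂ} (hg : Integrable g) :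
    Continuous fun x : ℝ => ∫ t : ℝ, Complex.exp (((t * x : ℝ) : ℂ) * Complex.I) * g t := by
  refine continuous_of_dominated (bound := fun t => ‖g t‖) (fun x => ?_)
    (fun x => Filter.Eventually.of_forall fun t => (norm_cexp_mul_I_mul _ _).le) hg.norm
    (Filter.Eventually.of_forall fun t => by fun_prop)
  have hc : Continuous fun t : ℝ => Complex.exp (((t * x : ℝ) : ℂ) * Complex.I) := by fun_prop
  exact hc.aestronglyMeasurable.mul hg.aestronglyMeasurable

theorem continuous_pattern {η : ℝ} (hη : 1 / 2 < η) (j k : ℕ) : Continuous (pattern η j k) := by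
  unfold pattern
  exact continuous_const.mul
    (continuous_integral_cexp_mul (integrable_patternFourier_mul_gauss j k (gam_lt hη)))

theorem norm_pattern_le (η : ℝ) (j k : ℕ) (x : ℝ) : ‖pattern η j k x‖ ≤ supNorm (pattern η j k) :=
  le_ciSup (bddAbove_pattern η j k) x

theorem supNorm_pattern_nonneg (η : ℝ) (j k : ℕ) : 0 ≤ supNorm (pattern η j k) :=
  (norm_nonneg _).trans (norm_pattern_le η j k 0)

theorem continuous_G {η : ℝ} (hη : 1 / 2 < η) (p : ℕ × ℕ) :
    Continuous fun z : ℝ × ℝ => G η p (z.1 / √η) z.2 := by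
  have := continuous_pattern hη p.1 p.2
  unfold G
  fun_prop

theorem norm_cexp_phase (a b : ℕ) (φ : ℝ) :
    ‖Complex.exp (-Complex.I * ((a : ℂ) - (b : ℂ)) * (φ : ℂ))‖ = 1 := by
  rw [show -Complex.I * ((a : ℂ) - (b : ℂ)) * (φ : ℂ) =
    ((-((a : ℝ) - b) * φ : ℝ) : ℂ) * Complex.I by push_cast; ring, Complex.norm_exp_ofReal_mul_I]

theorem norm_G_le (η : ℝ) (p : ℕ × ℕ) (x φ : ℝ) : ‖G η p x φ‖ ≤ supNorm (pattern η p.1 p.2) := by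
  rw [G, norm_mul, norm_cexp_phase, mul_one]
  exact norm_pattern_le _ _ _ _

theorem pattern_one (j k : ℕ) (x : ℝ) : pattern 1 j k x = 1 / (2 * Real.pi) *
    ∫ t : ℝ, Complex.exp (((t * x : ℝ) : ℂ) * Complex.I) * patternFourier j k t := by
  simp [pattern, gam]

/-- After division by √η the noise has standard deviation c with c²/2 = γ. Its characteristic
function e^{-γt²} cancels the deconvolution factor under the Fourier integral. -/
theorem integral_pattern_gaussian {η : ℝ} (hη : 1 / 2 < η) (hη1 : η ≤ 1) (j k : ℕ) (x : ℝ) :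
    ∫ ξ : ℝ, pattern η j k ((√η * x + √((1 - η) / 2) * ξ) / √η) ∂(gaussianReal 0 1) =
      pattern 1 j k x := by
  set c : ℝ := √((1 - η) / 2) / √η with hc
  have hη0 : 0 < η := by linarith
  have hc2 : c ^ 2 / 2 = gam η := by
    rw [hc, div_pow, Real.sq_sqrt (by linarith), Real.sq_sqrt hη0.le, gam]
    field_simp
    norm_num
  have harg : ∀ ξ : ℝ, (√η * x + √((1 - η) / 2) * ξ) / √η = x + c * ξ := by
    intro ξ
    have : √η ≠ 0 := by positivity
    rw [hc]
    field_simp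
  set g : ℝ → ℂ := fun t => patternFourier j k t * (Real.exp (gam η * t ^ 2) : ℂ) with hg
  have hgi : Integrable g := integrable_patternFourier_mul_gauss j k (gam_lt hη)
  have hint : Integrable (Function.uncurry fun (ξ t : ℝ) =>
      Complex.exp (((t * (x + c * ξ) : ℝ) : ℂ) * Complex.I) * g t)
      ((gaussianReal 0 1).prod volume) := by
    have hcont : Continuous fun w : ℝ × ℝ =>
      Complex.exp (((w.2 * (x + c * w.1) : ℝ) : ℂ) * Complex.I) := by fun_prop
    exact (hgi.comp_snd (gaussianReal 0 1)).bdd_mul (c := 1) hcont.aestronglyMeasurable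
      (Filter.Eventually.of_forall fun w => (Complex.norm_exp_ofReal_mul_I _).le)
  simp only [harg]
  rw [pattern_one]
  simp only [pattern]
  rw [integral_const_mul, integral_integral_swap hint]
  congr 2
  ext t
  rw [integral_mul_const]
  have hchar := charFun_gaussianReal (μ := 0) (v := 1) (t * c)
  rw [charFun_apply_real] at hchar
  have h1 : ∀ ξ : ℝ, Complex.exp (((t * (x + c * ξ) : ℝ) : ℂ) * Complex.I) =
      Complex.exp (((t * x : ℝ) : ℂ) * Complex.I) *
        Complex.exp (((t * c : ℝ) : ℂ) * ξ * Complex.I) := by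
    intro ξ
    rw [← Complex.exp_add]
    congr 1
    push_cast
    ring
  simp only [h1]
  rw [integral_const_mul, hchar, mul_assoc, hg]
  congr 1
  have h2 : Complex.exp (((t * c : ℝ) : ℂ) * ((0 : ℝ) : ℂ) * Complex.I -
      ((1 : NNReal) : ℂ) * ((t * c : ℝ) : ℂ) ^ 2 / 2) * (Real.exp (gam η * t ^ 2) : ℂ) = 1 := by
    rw [Complex.ofReal_exp, ← Complex.exp_add, ← hc2]
    push_cast
    rw [← Complex.exp_zero]
    congr 1
    simp
    ring
  calc _ = patternFourier j k t * (Complex.exp (((t * c : ℝ) : ℂ) * ((0 : ℝ) : ℂ) * Complex.I -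
      ((1 : NNReal) : ℂ) * ((t * c : ℝ) : ℂ) ^ 2 / 2) * (Real.exp (gam η * t ^ 2) : ℂ)) := by
        ring
    _ = _ := by rw [h2, mul_one]

theorem measurable_noise (η : ℝ) : Measurable fun w : (ℝ × ℝ) × ℝ =>
    (√η * w.1.1 + √((1 - η) / 2) * w.2, w.1.2) := by
  fun_prop

theorem isProbabilityMeasure_idealLaw {η : ℝ} {W : ℝ × ℝ → ℝ}
    (h : IsProbabilityMeasure (noisyLaw η W)) : IsProbabilityMeasure (idealLaw W) := by
  refine ⟨?_⟩
  have h1 := h.measure_univ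
  rw [noisyLaw, Measure.map_apply (measurable_noise η) MeasurableSet.univ, Set.preimage_univ,
    ← Set.univ_prod_univ, Measure.prod_prod, measure_univ (μ := gaussianReal 0 1), mul_one] at h1
  exact h1

/-- The characteristic function of a Wigner function. -/
def wignerChar (W : ℝ × ℝ → ℝ) (z : ℝ × ℝ) : ℂ :=
  ∫ y : ℝ × ℝ, Complex.exp (((z.1 * y.1 + z.2 * y.2 : ℝ) : ℂ) * Complex.I) * (W y : ℂ)

theorem continuous_wignerChar {W : ℝ × ℝ → ℝ} (hW : Integrable W) : Continuous (wignerChar W) := by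
  refine continuous_of_dominated (bound := fun y => ‖(W y : ℂ)‖) (fun z => ?_)
    (fun z => Filter.Eventually.of_forall fun t => (norm_cexp_mul_I_mul _ _).le) hW.ofReal.norm
    (Filter.Eventually.of_forall fun t => by fun_prop)
  have hc : Continuous fun y : ℝ × ℝ =>
    Complex.exp (((z.1 * y.1 + z.2 * y.2 : ℝ) : ℂ) * Complex.I) := by fun_prop
  exact hc.aestronglyMeasurable.mul hW.ofReal.aestronglyMeasurable

theorem norm_wignerChar_le (W : ℝ × ℝ → ℝ) (z : ℝ × ℝ) :
    ‖wignerChar W z‖ ≤ ∫ y : ℝ × ℝ, ‖(W y : ℂ)‖ := by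
  refine (norm_integral_le_integral_norm _).trans_eq ?_
  simp only [norm_cexp_mul_I_mul]

/-- Fourier slice theorem: by Fubini, the ridge function in direction φ samples the characteristic
function of W on the line of that direction. -/
theorem integral_mul_pattern_one {W : ℝ × ℝ → ℝ} (hW : Integrable W) (j k : ℕ) (φ : ℝ) :
    ∫ y : ℝ × ℝ, (W y : ℂ) * pattern 1 j k (y.1 * Real.cos φ + y.2 * Real.sin φ) =
      1 / (2 * Real.pi) *
        ∫ t : ℝ, wignerChar W (t * Real.cos φ, t * Real.sin φ) * patternFourier j k t := by
  have hint : Integrable (Function.uncurry fun (y : ℝ × ℝ) (t : ℝ) =>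
      Complex.exp (((t * (y.1 * Real.cos φ + y.2 * Real.sin φ) : ℝ) : ℂ) * Complex.I) *
        ((W y : ℂ) * patternFourier j k t)) (volume.prod volume) := by
    have hcont : Continuous fun w : (ℝ × ℝ) × ℝ => Complex.exp
      (((w.2 * (w.1.1 * Real.cos φ + w.1.2 * Real.sin φ) : ℝ) : ℂ) * Complex.I) := by fun_prop
    exact (hW.ofReal.mul_prod (integrable_patternFourier j k)).bdd_mul (c := 1)
      hcont.aestronglyMeasurable
      (Filter.Eventually.of_forall fun w => (Complex.norm_exp_ofReal_mul_I _).le)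
  simp only [pattern_one]
  calc _ = 1 / (2 * Real.pi) * ∫ y : ℝ × ℝ, ∫ t : ℝ,
      Complex.exp (((t * (y.1 * Real.cos φ + y.2 * Real.sin φ) : ℝ) : ℂ) * Complex.I) *
        ((W y : ℂ) * patternFourier j k t) := by
        rw [← integral_const_mul]
        congr 1
        ext y
        rw [mul_left_comm, ← integral_const_mul]
        congr 2
        ext t
        ring
    _ = _ := by
        rw [integral_integral_swap hint]
        congr 2
        ext t
        rw [wignerChar, ← integral_mul_const]
        congr 1
        ext y
        rw [show t * Real.cos φ * y.1 + t * Real.sin φ * y.2 =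
          t * (y.1 * Real.cos φ + y.2 * Real.sin φ) by ring]
        ring

/-- The constants cancel: 1/π from the density, 1/(2π) from Fourier inversion, π from
`patternFourier` and 2π from Moyal's identity. -/
theorem integral_G_idealLaw {ρ : H →L[ℂ] H} {W : ℝ × ℝ → ℝ}
    (hW : IsWignerFunction ρ W) (hρ : IsQuantumState ρ) [IsProbabilityMeasure (idealLaw W)]
    (j k : ℕ) :
    ∫ z : ℝ × ℝ, G 1 (j, k) z.1 z.2 ∂(idealLaw W) = densityMatrix ρ (j, k) := by
  have hc : Continuous fun z : ℝ × ℝ => G 1 (j, k) z.1 z.2 := by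
    have := continuous_pattern (η := 1) (by norm_num) j k
    unfold G
    fun_prop
  rw [integral_idealLaw hW hρ hc fun z => norm_G_le 1 (j, k) z.1 z.2]
  set F : ℝ × ℝ → ℂ := fun z => wignerChar W z * weylKernel j k z.1 z.2 with hF
  have hpol : ∀ φ t : ℝ, ((|t| : ℝ) : ℂ) * F (t * Real.cos φ, t * Real.sin φ) =
      (1 / Real.pi * Complex.exp (-Complex.I * ((k : ℂ) - (j : ℂ)) * (φ : ℂ))) *
        (wignerChar W (t * Real.cos φ, t * Real.sin φ) * patternFourier j k t) := by
    intro φ t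
    have h := patternFourier_mul_cexp j k t φ
    have hpi : (Real.pi : ℂ) ≠ 0 := by exact_mod_cast Real.pi_ne_zero
    simp only [hF]
    generalize Complex.exp (-Complex.I * ((k : ℂ) - (j : ℂ)) * (φ : ℂ)) = E at h ⊢
    field_simp
    linear_combination (-wignerChar W (t * Real.cos φ, t * Real.sin φ)) * h
  have hFi : Integrable (fun w : ℝ × ℝ =>
      ((|w.2| : ℝ) : ℂ) * F (w.2 * Real.cos w.1, w.2 * Real.sin w.1))
      ((volume.restrict (Set.Ioc (-Real.pi) Real.pi)).prod volume) := by
    simp only [hpol]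
    have hp : Integrable (fun w : ℝ × ℝ => patternFourier j k w.2)
        ((volume.restrict (Set.Ioc (-Real.pi) Real.pi)).prod volume) :=
      (integrable_patternFourier j k).comp_snd _
    have hχ := continuous_wignerChar hW.integrable
    have hχ' : Continuous fun w : ℝ × ℝ =>
      wignerChar W (w.2 * Real.cos w.1, w.2 * Real.sin w.1) := hχ.comp (by fun_prop)
    refine (hp.bdd_mul hχ'.aestronglyMeasurable (Filter.Eventually.of_forall fun w =>
      norm_wignerChar_le W _)).bdd_mul (c := ‖(1 / Real.pi : ℂ)‖)
      (Continuous.aestronglyMeasurable (by fun_prop)) (Filter.Eventually.of_forall fun w => ?_)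
    rw [norm_mul, norm_cexp_phase, mul_one]
  have h1 := integral_abs_mul_polar hFi
  have h2 : ∫ z, F z = 2 * Real.pi * densityMatrix ρ (j, k) :=
    integral_trace_mul_weylKernel hρ (fun z => hW.fourier z.1 z.2) j k
  have h3 : ∀ φ : ℝ, ∫ y : ℝ × ℝ, (W y : ℂ) *
      G 1 (j, k) (y.1 * Real.cos φ + y.2 * Real.sin φ) φ =
      1 / 2 * ∫ t : ℝ, ((|t| : ℝ) : ℂ) * F (t * Real.cos φ, t * Real.sin φ) := by
    intro φ
    have hpi : (Real.pi : ℂ) ≠ 0 := by exact_mod_cast Real.pi_ne_zero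
    have h4 : ∫ y : ℝ × ℝ, (W y : ℂ) * G 1 (j, k) (y.1 * Real.cos φ + y.2 * Real.sin φ) φ =
        (∫ y : ℝ × ℝ, (W y : ℂ) * pattern 1 j k (y.1 * Real.cos φ + y.2 * Real.sin φ)) *
          Complex.exp (-Complex.I * ((k : ℂ) - (j : ℂ)) * (φ : ℂ)) := by
      rw [← integral_mul_const]
      congr 1
      ext y
      simp only [G]
      ring
    simp only [hpol]
    rw [h4, integral_mul_pattern_one hW.integrable, integral_const_mul]
    generalize Complex.exp (-Complex.I * ((k : ℂ) - (j : ℂ)) * (φ : ℂ)) = E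
    generalize ∫ t : ℝ, wignerChar W (t * Real.cos φ, t * Real.sin φ) * patternFourier j k t = A
    field_simp
  simp only [h3]
  rw [integral_const_mul, h1, h2]
  have hpi : (Real.pi : ℂ) ≠ 0 := by exact_mod_cast Real.pi_ne_zero
  field_simp

theorem integral_G_noisyLaw {ρ : H →L[ℂ] H} {W : ℝ × ℝ → ℝ}
    (hW : IsWignerFunction ρ W) (hρ : IsQuantumState ρ) {η : ℝ} (hη : 1 / 2 < η) (hη1 : η ≤ 1)
    (hprob : IsProbabilityMeasure (noisyLaw η W)) (p : ℕ × ℕ) :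
    ∫ z : ℝ × ℝ, G η p (z.1 / √η) z.2 ∂(noisyLaw η W) = densityMatrix ρ p := by
  have := isProbabilityMeasure_idealLaw hprob
  have hc := continuous_G hη p
  have hm := measurable_noise η
  rw [noisyLaw, integral_map hm.aemeasurable hc.aestronglyMeasurable, integral_prod]
  · rw [← integral_G_idealLaw hW hρ p.1 p.2]
    congr 1
    ext z
    simp only [G]
    rw [integral_mul_const, integral_pattern_gaussian hη hη1]
  · refine Integrable.of_bound (C := supNorm (pattern η p.1 p.2))
      (hc.measurable.comp hm).aestronglyMeasurable
      (Filter.Eventually.of_forall fun w => norm_G_le _ _ _ _)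

/-! ### Soft thresholding -/

theorem softThreshold_of_norm_le {t : ℝ} {z : ℂ} (h : ‖z‖ ≤ t) : softThreshold t z = 0 := by
  simp [softThreshold, max_eq_right (sub_nonpos.mpr h)]

theorem softThreshold_of_lt {t : ℝ} {z : ℂ} (h : t < ‖z‖) :
    softThreshold t z = (((‖z‖ - t) / ‖z‖ : ℝ) : ℂ) * z := by
  rw [softThreshold, max_eq_left (by linarith)]
  push_cast
  ring

theorem norm_softThreshold_sub_le {t : ℝ} {z r : ℂ} (ht : 0 ≤ t) (h : ‖z - r‖ ≤ t) :
    ‖softThreshold t z - r‖ ≤ 2 * t := by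
  rcases le_or_gt ‖z‖ t with hz | hz
  · rw [softThreshold_of_norm_le hz, zero_sub, norm_neg]
    have := norm_sub_norm_le r z
    rw [norm_sub_rev] at this
    linarith
  · have hn : 0 < ‖z‖ := ht.trans_lt hz
    have h1 : ‖softThreshold t z - z‖ = t := by
      have : softThreshold t z - z = ((-(t / ‖z‖) : ℝ) : ℂ) * z := by
        rw [softThreshold_of_lt hz, sub_div, div_self hn.ne']
        push_cast
        ring
      rw [this, norm_mul, Complex.norm_real, norm_neg, Real.norm_of_nonneg (by positivity),
        div_mul_cancel₀ _ hn.ne']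
    have h2 := norm_add_le (softThreshold t z - z) (z - r)
    rw [sub_add_sub_cancel] at h2
    linarith

/-- When |z| > t the thresholded value is cz with c|z| = |z| - t, and the claim reduces to c|z|² ≤ 2
Re⟨z, r⟩. The hypothesis gives 2 Re⟨z, r⟩ ≥ |z|² - t², which is at least |z|(|z| - t). -/
theorem norm_softThreshold_sub_le_norm {t : ℝ} {z r : ℂ} (ht : 0 ≤ t) (h : ‖z - r‖ ≤ t) :
    ‖softThreshold t z - r‖ ≤ ‖r‖ := by
  rcases le_or_gt ‖z‖ t with hz | hz
  · rw [softThreshold_of_norm_le hz, zero_sub, norm_neg]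
  · have hn : 0 < ‖z‖ := ht.trans_lt hz
    rw [softThreshold_of_lt hz]
    set c : ℝ := (‖z‖ - t) / ‖z‖ with hc
    have hc0 : 0 ≤ c := div_nonneg (by linarith) hn.le
    have hcn : c * ‖z‖ = ‖z‖ - t := div_mul_cancel₀ _ hn.ne'
    have hsq : ‖z - r‖ ^ 2 ≤ t ^ 2 := by gcongr
    refine le_of_sq_le_sq ?_ (norm_nonneg r)
    rw [@norm_sub_sq ℂ] at hsq ⊢
    have hin : RCLike.re (inner ℂ ((c : ℂ) * z) r) = c * RCLike.re (inner ℂ z r) := by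
      rw [← smul_eq_mul, inner_smul_left, Complex.conj_ofReal]
      simp
    rw [hin, norm_mul, Complex.norm_real, Real.norm_of_nonneg hc0]
    have h1 : c * (‖z‖ * (c * ‖z‖)) ≤ c * (2 * RCLike.re (inner ℂ z r)) := by
      refine mul_le_mul_of_nonneg_left ?_ hc0
      rw [hcn]
      nlinarith [sq_nonneg ‖r‖]
    nlinarith

theorem threshold_nonneg (η ε : ℝ) (N n : ℕ) (p : ℕ × ℕ) : 0 ≤ threshold η ε N n p :=
  mul_nonneg (mul_nonneg zero_le_two (supNorm_pattern_nonneg _ _ _)) (Real.sqrt_nonneg _)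

/-- The oracle inequality, on the event where the initial estimator is uniformly accurate. -/
theorem oracle_inequality (r : ℕ × ℕ → ℂ) (η ε : ℝ) (N : ℕ) {n : ℕ} (y φ : Fin n → ℝ)
    (h : ∀ p ∈ J N, ‖initialEst η N y φ p - r p‖ ≤ threshold η ε N n p)
    (I : Finset (ℕ × ℕ)) (hI : I ⊆ J N) :
    sqNorm (fun p => finalEst η ε N y φ p - r p) ≤
      4 * ∑ p ∈ I, ENNReal.ofReal (threshold η ε N n p ^ 2) +
        ∑' p : {p : ℕ × ℕ // p ∉ I}, ENNReal.ofReal (‖r p.1‖ ^ 2) := by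
  rw [sqNorm, ← ENNReal.sum_add_tsum_compl I, Finset.mul_sum]
  refine add_le_add (Finset.sum_le_sum fun p hp => ?_) (ENNReal.tsum_le_tsum fun p => ?_)
  · have h1 := norm_softThreshold_sub_le (threshold_nonneg η ε N n p) (h p (hI hp))
    rw [show (4 : ℝ≥0∞) = ENNReal.ofReal 4 by simp, ← ENNReal.ofReal_mul (by norm_num)]
    refine ENNReal.ofReal_le_ofReal ?_
    refine (pow_le_pow_left₀ (norm_nonneg _) h1 2).trans_eq ?_
    ring
  · refine ENNReal.ofReal_le_ofReal (pow_le_pow_left₀ (norm_nonneg _) ?_ 2)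
    by_cases hp : p.1 ∈ J N
    · exact norm_softThreshold_sub_le_norm (threshold_nonneg η ε N n p.1) (h p.1 hp)
    · rw [finalEst, initialEst, if_neg hp]
      simp [softThreshold]

/-! ### Concentration of the initial estimator -/

theorem card_J (N : ℕ) : ((J N).card : ℝ) * 2 = N * (N + 1) := by
  have h : (J N).card = ∑ m ∈ Finset.range N, (m + 1) := by
    have hJ : J N = (Finset.range N).biUnion fun m => Finset.HasAntidiagonal.antidiagonal m := by
      ext p
      simp [mem_J]
    rw [hJ, Finset.card_biUnion]
    · simp
    · intro a _ b _ hab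
      rw [Function.onFun, Finset.disjoint_left]
      intro p hp hp'
      rw [Finset.HasAntidiagonal.mem_antidiagonal] at hp hp'
      exact hab (hp.symm.trans hp')
  rw [h]
  clear h
  induction N with
  | zero => simp
  | succ N ih =>
    rw [Finset.sum_range_succ]
    push_cast at ih ⊢
    linarith

/-- Each centred summand is sub-Gaussian with variance proxy M², so the exponent is -(ns)²/(2nM²),
which `hL` makes equal to -L. -/
theorem hoeffding_bounded {Ω E : Type*} [MeasurableSpace Ω] [MeasurableSpace E] {P : Measure Ω}
    [IsProbabilityMeasure P] {n : ℕ} {Z : Fin n → Ω → E} {ν : Measure E}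
    (hlaw : ∀ l, HasLaw (Z l) ν P) (hindep : iIndepFun Z P) {f : E → ℝ} (hf : Measurable f)
    {M : ℝ} (hM : 0 < M) (hbd : ∀ z, |f z| ≤ M) {s L : ℝ} (hs : 0 ≤ s)
    (hL : n * s ^ 2 = 2 * M ^ 2 * L) (hn : 0 < n) :
    P {ω | n * s ≤ ∑ l, (f (Z l ω) - ∫ z, f z ∂ν)} ≤ ENNReal.ofReal (Real.exp (-L)) := by
  have hsub : ∀ l ∈ (Finset.univ : Finset (Fin n)),
      HasSubgaussianMGF (fun ω => f (Z l ω) - ∫ z, f z ∂ν) ((‖M - -M‖₊ / 2) ^ 2) P := by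
    intro l _
    have h := hasSubgaussianMGF_of_mem_Icc (μ := P) (X := fun ω => f (Z l ω)) (a := -M) (b := M)
      (hf.comp_aemeasurable (hlaw l).aemeasurable)
      (Filter.Eventually.of_forall fun ω => abs_le.mp (hbd _))
    have hmean : ∫ ω, f (Z l ω) ∂P = ∫ z, f z ∂ν := by
      rw [← (hlaw l).map_eq, integral_map (hlaw l).aemeasurable hf.aestronglyMeasurable]
    rwa [hmean] at h
  have hind : iIndepFun (fun l ω => f (Z l ω) - ∫ z, f z ∂ν) P :=
    hindep.comp (fun _ z => f z - ∫ z, f z ∂ν) fun _ => hf.sub_const _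
  have h := HasSubgaussianMGF.measure_sum_ge_le_of_iIndepFun hind hsub
    (ε := n * s) (by positivity)
  rw [← ofReal_measureReal]
  refine ENNReal.ofReal_le_ofReal (h.trans (Real.exp_le_exp.mpr (le_of_eq ?_)))
  have hn' : (0 : ℝ) < n := by exact_mod_cast hn
  have hcoe : ((∑ _l : Fin n, (‖M - -M‖₊ / 2) ^ 2 : NNReal) : ℝ) = n * M ^ 2 := by
    simp only [Finset.sum_const, Finset.card_univ, Fintype.card_fin, nsmul_eq_mul]
    push_cast
    rw [sub_neg_eq_add, Real.norm_of_nonneg (by positivity)]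
    ring
  rw [hcoe]
  rw [mul_pow, sq (n : ℝ), mul_assoc, hL]
  field_simp

/-- The four one-sided tails of real and imaginary parts are taken at level s = √2 M √(L/n). If none
occurs, the modulus is at most √2 s = 2M√(L/n), whence the factor 2 in the thresholds. -/
theorem hoeffding_bounded_complex {Ω E : Type*} [MeasurableSpace Ω] [MeasurableSpace E]
    {P : Measure Ω} [IsProbabilityMeasure P] {n : ℕ} {Z : Fin n → Ω → E} {ν : Measure E}
    [IsProbabilityMeasure ν]
    (hlaw : ∀ l, HasLaw (Z l) ν P) (hindep : iIndepFun Z P) {g : E → ℂ} (hg : Measurable g)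
    {M : ℝ} (hbd : ∀ z, ‖g z‖ ≤ M) {L : ℝ} (hL : 0 ≤ L) (hn : 0 < n) :
    P {ω | 2 * M * √(L / n) < ‖1 / (n : ℂ) * ∑ l, g (Z l ω) - ∫ z, g z ∂ν‖} ≤
      4 * ENNReal.ofReal (Real.exp (-L)) := by
  have hn' : (0 : ℝ) < n := by exact_mod_cast hn
  have hnC : (n : ℂ) ≠ 0 := by exact_mod_cast hn.ne'
  have hE : Nonempty E := by
    by_contra h
    rw [not_nonempty_iff] at h
    have h1 := measure_univ (μ := ν)
    rw [Set.univ_eq_empty_iff.mpr h, measure_empty] at h1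
    exact zero_ne_one h1
  have hM0 : 0 ≤ M := (norm_nonneg _).trans (hbd hE.some)
  rcases hM0.eq_or_lt with rfl | hM
  -- For M = 0 the function vanishes and the strict inequality defines an empty event.
  · have hg0 : ∀ z, g z = 0 := fun z => norm_le_zero_iff.mp (hbd z)
    simp [hg0]
  have hgi : Integrable g ν := Integrable.of_bound hg.aestronglyMeasurable M
    (Filter.Eventually.of_forall hbd)
  set s : ℝ := √2 * M * √(L / n) with hs
  have hs0 : 0 ≤ s := by positivity
  have hsL : n * s ^ 2 = 2 * M ^ 2 * L := by
    rw [hs, mul_pow, mul_pow, Real.sq_sqrt (by norm_num), Real.sq_sqrt (by positivity)]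
    field_simp
  have key : ∀ f : E → ℝ, Measurable f → (∀ z, |f z| ≤ M) →
      P {ω | n * s ≤ ∑ l, (f (Z l ω) - ∫ z, f z ∂ν)} ≤ ENNReal.ofReal (Real.exp (-L)) :=
    fun f hf hfb => hoeffding_bounded hlaw hindep hf hM hfb hs0 hsL hn
  have hre : Measurable fun z => (g z).re := Complex.measurable_re.comp hg
  have him : Measurable fun z => (g z).im := Complex.measurable_im.comp hg
  have hreb : ∀ z, |(g z).re| ≤ M := fun z => (Complex.abs_re_le_norm _).trans (hbd z)
  have himb : ∀ z, |(g z).im| ≤ M := fun z => (Complex.abs_im_le_norm _).trans (hbd z)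
  have h1 := key _ hre hreb
  have h2 := key _ hre.neg (by simpa using hreb)
  have h3 := key _ him himb
  have h4 := key _ him.neg (by simpa using himb)
  refine (measure_mono (t := (_ ∪ _) ∪ (_ ∪ _)) ?_).trans ((measure_union_le _ _).trans
    ((add_le_add ((measure_union_le _ _).trans (add_le_add h1 h2))
      ((measure_union_le _ _).trans (add_le_add h3 h4))).trans_eq (by ring)))
  intro ω hω
  simp only [Set.mem_ofPred_eq] at hω
  by_contra hcon
  simp only [Set.mem_union, Set.mem_ofPred_eq, not_or, not_le, Pi.neg_apply, integral_neg,
    Finset.sum_sub_distrib, Finset.sum_neg_distrib, Finset.sum_const, Finset.card_univ,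
    Fintype.card_fin, nsmul_eq_mul] at hcon
  obtain ⟨⟨k1, k2⟩, k3, k4⟩ := hcon
  set D : ℂ := 1 / (n : ℂ) * ∑ l, g (Z l ω) - ∫ z, g z ∂ν with hD
  have hnD : (n : ℂ) * D = ∑ l, g (Z l ω) - n * ∫ z, g z ∂ν := by
    rw [hD]
    field_simp
  have hDre : n * D.re = ∑ l, (g (Z l ω)).re - n * ∫ z, (g z).re ∂ν := by
    have := congrArg Complex.re hnD
    have h5 := integral_re hgi
    simp only [RCLike.re_to_complex] at h5
    rw [h5]
    simpa using this
  have hDim : n * D.im = ∑ l, (g (Z l ω)).im - n * ∫ z, (g z).im ∂ν := by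
    have := congrArg Complex.im hnD
    have h5 := integral_im hgi
    simp only [RCLike.im_to_complex] at h5
    rw [h5]
    simpa using this
  have hr : |D.re| < s := by
    rw [abs_lt]
    constructor <;> refine lt_of_mul_lt_mul_left ?_ hn'.le <;> linarith
  have hi : |D.im| < s := by
    rw [abs_lt]
    constructor <;> refine lt_of_mul_lt_mul_left ?_ hn'.le <;> linarith
  have hsq : ‖D‖ ^ 2 ≤ (2 * M * √(L / n)) ^ 2 := by
    have h6 : (2 * M * √(L / n)) ^ 2 = 2 * s ^ 2 := by
      rw [hs]
      simp only [mul_pow, Real.sq_sqrt (show (0 : ℝ) ≤ 2 by norm_num)]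
      ring
    rw [h6, ← Complex.normSq_eq_norm_sq, Complex.normSq_apply]
    have h7 := sq_lt_sq' (by linarith [abs_lt.mp hr] : -s < D.re) (abs_lt.mp hr).2
    have h8 := sq_lt_sq' (by linarith [abs_lt.mp hi] : -s < D.im) (abs_lt.mp hi).2
    nlinarith
  exact absurd (le_of_sq_le_sq hsq (by positivity)) (not_le.mpr hω)

end QHT

end

/-! ### The union bound and the main theorem -/

theorem proposition1
    (ρ : QHT.H →L[ℂ] QHT.H) (hρ : QHT.IsQuantumState ρ)
    (W : ℝ × ℝ → ℝ) (hW : QHT.IsWignerFunction ρ W)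
    (η : ℝ) (hη : 1 / 2 < η) (hη1 : η ≤ 1)
    (ε : ℝ) (hε : 0 < ε) (hε1 : ε < 1)
    (N n : ℕ) (hn : 0 < n)
    {Ω : Type*} [MeasurableSpace Ω] (P : Measure Ω) [IsProbabilityMeasure P]
    (Y Φ : Fin n → Ω → ℝ)
    (hlaw : ∀ l, HasLaw (fun ω => (Y l ω, Φ l ω)) (QHT.noisyLaw η W) P)
    (hindep : iIndepFun (fun l ω => (Y l ω, Φ l ω)) P) :
    ENNReal.ofReal (1 - ε) ≤
      P {ω |
        QHT.sqNorm (fun p => QHT.finalEst η ε N (fun l => Y l ω) (fun l => Φ l ω) p -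
            QHT.densityMatrix ρ p) ≤
          ⨅ I : Finset (ℕ × ℕ), ⨅ _ : I ⊆ QHT.J N,
            (4 * ∑ p ∈ I, ENNReal.ofReal (QHT.threshold η ε N n p ^ 2) +
              ∑' p : {p : ℕ × ℕ // p ∉ I},
                ENNReal.ofReal (‖QHT.densityMatrix ρ p.1‖ ^ 2))} := by
  set good : Set Ω := _
  change _ ≤ P good
  have hprob : IsProbabilityMeasure (QHT.noisyLaw η W) :=
    (hlaw ⟨0, hn⟩).isProbabilityMeasure_iff.mp inferInstance
  set bad : ℕ × ℕ → Set Ω := fun p => {ω | QHT.threshold η ε N n p <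
    ‖QHT.initialEst η N (fun l => Y l ω) (fun l => Φ l ω) p - QHT.densityMatrix ρ p‖} with hbad
  -- A covering, rather than a complement, needs only subadditivity and no measurability of these
  -- events.
  have hcover : Set.univ ⊆ good ∪ ⋃ p ∈ QHT.J N, bad p := by
    intro ω _
    by_cases hω : ω ∈ ⋃ p ∈ QHT.J N, bad p
    · exact Or.inr hω
    · left
      refine le_iInf₂ (α := ℝ≥0∞) fun I hI => ?_
      refine QHT.oracle_inequality _ η ε N _ _ (fun p hp => ?_) I hI
      by_contra hlt
      exact hω (Set.mem_biUnion hp (not_le.mp hlt))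
  -- The logarithm in the threshold makes e^{-L} = ε/(2N(N+1)); the four tails multiply it by 4.
  -- Summing over the N(N+1)/2 indices then gives ε.
  have hbadp : ∀ p ∈ QHT.J N, P (bad p) ≤ ENNReal.ofReal (2 * ε / (N * (N + 1))) := by
    intro p hp
    have hN : 1 ≤ N := by
      have := QHT.mem_J.mp hp
      omega
    have hN' : (1 : ℝ) ≤ N := by exact_mod_cast hN
    have hL : 0 ≤ Real.log (2 * N * (N + 1) / ε) := by
      refine Real.log_nonneg ?_
      rw [one_le_div hε]
      nlinarith
    have h := QHT.hoeffding_bounded_complex hlaw hindep (QHT.continuous_G hη p).measurable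
      (fun z => QHT.norm_G_le η p _ _) hL hn
    rw [QHT.integral_G_noisyLaw hW hρ hη hη1 hprob, Real.exp_neg,
      Real.exp_log (by positivity)] at h
    simp only [hbad, QHT.initialEst, if_pos hp, QHT.threshold]
    refine h.trans_eq ?_
    rw [show (4 : ℝ≥0∞) = ENNReal.ofReal 4 by simp, ← ENNReal.ofReal_mul (by norm_num)]
    congr 1
    field_simp
    norm_num
  have hsum : P (⋃ p ∈ QHT.J N, bad p) ≤ ENNReal.ofReal ε := by
    refine (measure_biUnion_finset_le _ _).trans ((Finset.sum_le_sum hbadp).trans ?_)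
    rw [Finset.sum_const, nsmul_eq_mul, ← ENNReal.ofReal_natCast,
      ← ENNReal.ofReal_mul (Nat.cast_nonneg _)]
    refine ENNReal.ofReal_le_ofReal ?_
    have hc := QHT.card_J N
    rcases Nat.eq_zero_or_pos N with rfl | hN
    · simpa using hε.le
    · have hN' : (0 : ℝ) < N := by exact_mod_cast hN
      rw [mul_div_assoc', div_le_iff₀ (by positivity), ← hc]
      linarith
  have h1 : 1 ≤ P good + ENNReal.ofReal ε := by
    calc (1 : ℝ≥0∞) = P Set.univ := measure_univ.symm
      _ ≤ P good + P (⋃ p ∈ QHT.J N, bad p) := (measure_mono hcover).trans (measure_union_le _ _)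
      _ ≤ _ := by gcongr
  rw [ENNReal.ofReal_sub _ hε.le, ENNReal.ofReal_one]
  exact tsub_le_iff_right.mpr h1
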